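/- Throughout, $\log$ is to base $2$, $\lambda\in\mathbb N$ is the security parameter, $d(\lambda)=n(\lambda)=\lceil\log\lambda\rceil$ (read as $0$ for $\lambda=0$), and $\|A\|_F$ is the Frobenius norm. **Generator.** A QPT algorithm is a family of quantum circuits (gates $H,T,CNOT$, with qubits initialized to zero and qubits traced out) of size polynomial in $\lambda$. Let $G=\{G_\lambda\}$ be a selectively secure $(d(\lambda)+1,n(\lambda))$-pseudorandom function-like state (PRFS) generator: $G$ is a QPT algorithm which on a key $k\in\{0,1\}^\lambda$ and an input $x\in\{0,1\}^{d(\lambda)+1}$ outputs an $n(\lambda)$-qubit state $G_\lambda(k,x)$, and for all polynomially bounded $s,t$, every non-uniform QPT distinguisher $A$ with quantum advice $\rho_\lambda$ and every family of pairwise distinct inputs $x_1,\dots,x_{s(\lambda)}$, the probability that $A_\lambda$ outputs $1$ on $(\rho_\lambda,x_1,\dots,x_s,G_\lambda(k,x_1)^{\otimes t},\dots,G_\lambda(k,x_s)^{\otimes t})$ with $k$ uniform, and the probability that it outputs $1$ on $(\rho_\lambda,x_1,\dots,x_s,|\vartheta_1\rangle^{\otimes t},\dots,|\vartheta_s\rangle^{\otimes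 t})$ with independent Haar-random $n(\lambda)$-qubit states $|\vartheta_i\rangle$, differ by at most a negligible function of $\lambda$. Assume that $G$ has recognizable abort: $G_\lambda(k,x)$ is obtained by tracing out the first qubit of the output of a quantum algorithm $\widehat G_\lambda(k,x)$, and this output has the form $\eta\,|0\rangle\langle 0|\otimes|\psi\rangle\langle\psi|+(1-\eta)|\bot\rangle\langle\bot|$, where $\eta\in[0,1]$ and the unit vector $|\psi\rangle$ may depend on $(k,x)$ and $|\bot\rangle=|1\rangle|\widehat\bot\rangle$ depends only on $\lambda$. **Tomography.** For an $n$-qubit state $\rho$ put $N=2^n$. The procedure $\mathcal T$ with parameter $s$ measures each of the $N^2$ $n$-qubit Pauli observables $P$ on $s$ fresh copies of $\rho$ and outputs $2^{-n}\sum_P m_P P$, where $m_P$ is the average of the $s$ outcomes $\pm1$ for $P$. The procedure $\mathsf{Tomography}$ takes $s=2^{n+9}$ and $L=4sN^2\lambda=2^{3n+11}\lambda$ copies of $\rho$, runs $\mathcal T$ with parameter $4s$ independently $\lambda$ times to obtain $M_1,\dots,M_\lambda$, and outputs the first $M_{i}$ with $|\{j:\|M_j-M_{i}\|_F^2\le 4N/s\}|>\lambda/2$,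 or a failure symbol if there is none. For $k\in\{0,1\}^\lambda$, $i\in\{0,1\}^{d}$, $b\in\{0,1\}$, the algorithm $\mathsf{Verify}((k,i,b),u)$ computes a fresh $\widehat M\leftarrow\mathsf{Tomography}(G_\lambda(k,i\|b)^{\otimes L})$ and outputs $\mathsf{Valid}$ if neither $u$ nor $\widehat M$ is the failure symbol and $\|u-\widehat M\|_F^2\le 9/128$, and $\mathsf{Invalid}$ otherwise. **Encryption.** Let $M(\lambda)\le 2^{d(\lambda)}$, and identify the elements of $[M(\lambda)]$ with distinct strings in $\{0,1\}^{d(\lambda)}$ by binary expansion. For $k\in\{0,1\}^\lambda$ and $x\in\{0,1\}^{M(\lambda)}$, $\mathsf{Enc}_\lambda(k,x)$ outputs the classical ciphertext $(u_i)_{i\in[M(\lambda)]}$ with independent $u_i\leftarrow\mathsf{Tomography}(G_\lambda(k,i\|x_i)^{\otimes L})$. $\mathsf{Dec}_\lambda(k,(u_i)_i)$ runs $\mathsf{Verify}((k,i,0),u_i)$ for each $i$, sets $x_i=0$ if the result is $\mathsf{Valid}$ and $x_i=1$ otherwise, and outputs $x_1\cdots x_{M(\lambda)}$. **Theorem.**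 $(\mathsf{Enc},\mathsf{Dec})$ satisfies the correctness property of a pseudo one-time pad: there is a negligible function $\varepsilon$ such that for every $\lambda$ and every $x\in\{0,1\}^{M(\lambda)}$, $$\Pr_{\substack{k\leftarrow\{0,1\}^\lambda\\ \mathsf{ct}\leftarrow\mathsf{Enc}_\lambda(k,x)}}\left[\mathsf{Dec}_\lambda(k,\mathsf{ct})=x\right]\ \ge\ 1-\varepsilon(\lambda).$$ -/

import Mathlib

open MeasureTheory Matrix Filter
open scoped ComplexConjugate ComplexOrder

noncomputable section

namespace PseudoOTP

/-! ### States, kets and the Haar measure -/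

/-- Operators on the Hilbert space of qubits labelled by `W`, as matrices in the computational
basis.  A basis vector is an assignment `W → Bool`. -/
abbrev Op (W : Type) : Type := Matrix (W → Bool) (W → Bool) ℂ

/-- Density matrices: positive semidefinite of trace one. -/
def IsDensity {W : Type} [Fintype W] [DecidableEq W] (ρ : Op W) : Prop :=
  ρ.PosSemidef ∧ ρ.trace = 1

/-- The state `|v⟩⟨v|` of a computational basis vector. -/
def basisState {W : Type} [Fintype W] [DecidableEq W] (v : W → Bool) : Op W :=
  Matrix.of fun a b => if a = v ∧ b = v then 1 else 0

/-- State vectors of qubits labelled by `W`, with the Euclidean norm. -/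
abbrev Ket (W : Type) [Fintype W] [DecidableEq W] : Type := EuclideanSpace ℂ (W → Bool)

/-- The projector `|ψ⟩⟨ψ|`. -/
def ketbra {W : Type} [Fintype W] [DecidableEq W] (ψ : Ket W) : Op W :=
  Matrix.of fun a b => ψ a * conj (ψ b)

/-- The Haar measure on pure states: the uniform probability measure on the unit sphere. -/
def haar (W : Type) [Fintype W] [DecidableEq W] : Measure (Metric.sphere (0 : Ket W) 1) :=
  ((Measure.addHaar : Measure (Ket W)).toSphere Set.univ)⁻¹ •
    (Measure.addHaar : Measure (Ket W)).toSphere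

/-! ### Generalized quantum circuits over the gate set {H, T, CNOT} -/

/-- Elementary gates acting on wires labelled by `W`. -/
inductive Gate (W : Type) : Type
  | H (i : W) : Gate W
  | T (i : W) : Gate W
  | CNOT (c t : W) (h : c ≠ t) : Gate W

/-- The unitary of an elementary gate, on all wires. -/
def Gate.toOp {W : Type} [Fintype W] [DecidableEq W] : Gate W → Op W
  | .H i => Matrix.of fun a b =>
      if ∀ j, j ≠ i → a j = b j then
        (if a i = true ∧ b i = true then -1 else 1) * ((Real.sqrt 2)⁻¹ : ℂ) else 0
  | .T i => Matrix.diagonal fun a =>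
      if a i = true then Complex.exp (Real.pi / 4 * Complex.I) else 1
  | .CNOT c t _ => Matrix.of fun a b =>
      if a = Function.update b t (xor (b t) (b c)) then 1 else 0

/-- A generalized quantum circuit: besides the input qubits there are `anc` qubits initialized to
zero; `gates` are applied in the order of the list; all wires that are not output wires are traced
out at the end. -/
structure Circuit (In Out : Type) : Type where
  anc : ℕ
  gates : List (Gate (In ⊕ Fin anc))
  out : Out ↪ In ⊕ Fin anc

namespace Circuit

variable {In Out : Type} [Fintype In] [DecidableEq In] [Fintype Out] [DecidableEq Out]

/-- Number of gates plus numbers of input and output wires, including the initialized ones and the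
ones that are traced out. -/
def size (C : Circuit In Out) : ℕ :=
  C.gates.length + Fintype.card (In ⊕ Fin C.anc) + Fintype.card (In ⊕ Fin C.anc)

/-- The unitary part of the circuit (the head of the list is applied first). -/
def unitary (C : Circuit In Out) : Op (In ⊕ Fin C.anc) :=
  C.gates.foldl (fun U g => g.toOp * U) 1

/-- `ρ ⊗ |0⋯0⟩⟨0⋯0|`. -/
def withAncillas (C : Circuit In Out) (ρ : Op In) : Op (In ⊕ Fin C.anc) :=
  Matrix.of fun a b =>
    if (∀ j, a (Sum.inr j) = false) ∧ (∀ j, b (Sum.inr j) = false) then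
      ρ (fun i => a (Sum.inl i)) (fun i => b (Sum.inl i)) else 0

/-- Partial trace over all wires that are not output wires. -/
def keepOut (C : Circuit In Out) (σ : Op (In ⊕ Fin C.anc)) : Op Out :=
  Matrix.of fun a b => ∑ c : In ⊕ Fin C.anc → Bool, ∑ c' : In ⊕ Fin C.anc → Bool,
    if (∀ o, c (C.out o) = a o) ∧ (∀ o, c' (C.out o) = b o) ∧
        (∀ w, (∀ o, C.out o ≠ w) → c w = c' w) then σ c c' else 0

/-- The channel of the circuit. -/
def run (C : Circuit In Out) (ρ : Op In) : Op Out :=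
  C.keepOut (C.unitary * C.withAncillas ρ * C.unitaryᴴ)

/-- The probability that a circuit with one output qubit outputs `1`. -/
def acceptProb (C : Circuit In (Fin 1)) (ρ : Op In) : ℝ :=
  (C.run ρ (fun _ => true) (fun _ => true)).re

end Circuit

/-- Quantum polynomial time: the circuit sizes are bounded by a polynomial. -/
def IsQPT {In Out : ℕ → Type} [∀ l, Fintype (In l)]
    (C : ∀ l, Circuit (In l) (Out l)) : Prop :=
  ∃ p : Polynomial ℕ, ∀ l, (C l).size ≤ p.eval l

/-- Functions of the security parameter that are bounded by a polynomial. -/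
def PolyBounded (f : ℕ → ℕ) : Prop :=
  ∃ p : Polynomial ℕ, ∀ l, f l ≤ p.eval l

/-- Negligible functions of the security parameter. -/
def Negligible (ε : ℕ → ℝ) : Prop :=
  Asymptotics.SuperpolynomialDecay atTop (fun l : ℕ => (l : ℝ)) ε

/-! ### Pseudorandom function-like state generators -/

/-- State generation algorithms: on a key of `l` bits and an input of `d l` bits, the circuit for
security parameter `l` outputs an `n l`-qubit state. -/
abbrev Generator (d n : ℕ → ℕ) : Type := ∀ l, Circuit (Fin l ⊕ Fin (d l)) (Fin (n l))

/-- The state `G_l(k, x)`. -/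
def Generator.state {d n : ℕ → ℕ} (G : Generator d n) (l : ℕ) (k : Fin l → Bool)
    (x : Fin (d l) → Bool) : Op (Fin (n l)) :=
  (G l).run (basisState (Sum.elim k x))

/-- The qubits handed to a distinguisher: `s` strings of `d` bits, `t` copies of each of `s` states
of `n` qubits, and `q` qubits of advice. -/
abbrev ChallengeWires (s t d n q : ℕ) : Type :=
  ((Fin s × Fin d) ⊕ (Fin s × Fin t × Fin n)) ⊕ Fin q

/-- The state `|x₁,…,x_s⟩⟨x₁,…,x_s| ⊗ σ₁^{⊗t} ⊗ ⋯ ⊗ σ_s^{⊗t} ⊗ α`. -/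
def challenge {s d n q : ℕ} (t : ℕ) (x : Fin s → Fin d → Bool) (σ : Fin s → Op (Fin n))
    (α : Op (Fin q)) : Op (ChallengeWires s t d n q) :=
  Matrix.of fun a b =>
    basisState (fun ij : Fin s × Fin d => x ij.1 ij.2)
        (fun ij => a (Sum.inl (Sum.inl ij))) (fun ij => b (Sum.inl (Sum.inl ij))) *
      (∏ i : Fin s, ∏ j : Fin t,
        σ i (fun m => a (Sum.inl (Sum.inr (i, j, m)))) (fun m => b (Sum.inl (Sum.inr (i, j, m))))) *
      α (fun m => a (Sum.inr m)) (fun m => b (Sum.inr m))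

/-- The probability that the distinguisher accepts the states `G_l(k, xᵢ)` for a uniform key `k`. -/
def realProb {d n : ℕ → ℕ} (G : Generator d n) (l s t q : ℕ)
    (A : Circuit (ChallengeWires s t (d l) (n l) q) (Fin 1)) (α : Op (Fin q))
    (x : Fin s → Fin (d l) → Bool) : ℝ :=
  (∑ k : Fin l → Bool, A.acceptProb (challenge t x (fun i => G.state l k (x i)) α)) / 2 ^ l

/-- The probability that the distinguisher accepts independent Haar-random states. -/
def haarProb (s t d n q : ℕ) (A : Circuit (ChallengeWires s t d n q) (Fin 1)) (α : Op (Fin q))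
    (x : Fin s → Fin d → Bool) : ℝ :=
  ∫ θ, A.acceptProb (challenge t x (fun i => ketbra (θ i).1) α)
    ∂(Measure.pi fun _ : Fin s => haar (Fin n))

/-- Selectively secure pseudorandom function-like state generators with input length `d` and output
length `n`, secure against non-uniform distinguishers with quantum advice.  The queried inputs form
a set, hence are pairwise distinct. -/
def IsPRFS {d n : ℕ → ℕ} (G : Generator d n) : Prop :=
  IsQPT G ∧
  ∀ (s t q : ℕ → ℕ)
    (A : ∀ l, Circuit (ChallengeWires (s l) (t l) (d l) (n l) (q l)) (Fin 1))
    (α : ∀ l, Op (Fin (q l)))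
    (x : ∀ l, Fin (s l) → Fin (d l) → Bool),
    PolyBounded s → PolyBounded t → IsQPT A → (∀ l, IsDensity (α l)) → (∀ l, Function.Injective (x l)) →
    ∃ ε : ℕ → ℝ, Negligible ε ∧ ∀ l,
      |realProb G l (s l) (t l) (q l) (A l) (α l) (x l) -
        haarProb (s l) (t l) (d l) (n l) (q l) (A l) (α l) (x l)| ≤ ε l

/-- `|b⟩⟨b| ⊗ ρ`, where `b` is the value of the first qubit. -/
def flagged {n : ℕ} (b : Bool) (ρ : Op (Fin n)) : Op (Fin (n + 1)) :=
  Matrix.of fun u v => if u 0 = b ∧ v 0 = b then ρ (Fin.tail u) (Fin.tail v) else 0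

/-- Partial trace over the first qubit. -/
def traceFirst {n : ℕ} (ρ : Op (Fin (n + 1))) : Op (Fin n) :=
  Matrix.of fun u v => ∑ b : Bool, ρ (Fin.cons b u) (Fin.cons b v)

/-- Recognizable abort: `G` runs an algorithm whose output has the form
`η |0⟩⟨0| ⊗ |ψ⟩⟨ψ| + (1 - η) |⊥⟩⟨⊥|`, with `|⊥⟩ = |1⟩|bot⟩` independent of key and input, and traces
out the first qubit. -/
def RecognizableAbort {d n : ℕ → ℕ} (G : Generator d n) : Prop :=
  ∃ (G' : Generator d (fun l => n l + 1)) (bot : ∀ l, Ket (Fin (n l))),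
    (∀ l, ‖bot l‖ = 1) ∧
    ∀ (l : ℕ) (k : Fin l → Bool) (x : Fin (d l) → Bool),
      (∃ (η : ℝ) (ψ : Ket (Fin (n l))), 0 ≤ η ∧ η ≤ 1 ∧ ‖ψ‖ = 1 ∧
        G'.state l k x =
          (η : ℂ) • flagged false (ketbra ψ) + ((1 - η : ℝ) : ℂ) • flagged true (ketbra (bot l))) ∧
      G.state l k x = traceFirst (G'.state l k x)

/-! ### Randomized procedures -/

theorem tsum_pi_prod {ι α : Type} [Fintype ι] (f : ι → α → ENNReal) :
    ∑' ω : ι → α, ∏ i, f i (ω i) = ∏ i, ∑' a, f i a := by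
  classical
  have key : ∀ (m : ℕ) (g : Fin m → α → ENNReal),
      ∑' ω : Fin m → α, ∏ i, g i (ω i) = ∏ i, ∑' a, g i a := by
    intro m
    induction m with
    | zero => intro g; simp [tsum_fintype]
    | succ m ih =>
      intro g
      rw [← (Fin.consEquiv fun _ : Fin (m + 1) => α).tsum_eq, ENNReal.tsum_prod', Fin.prod_univ_succ,
        ← ih (fun i => g i.succ), ← ENNReal.tsum_mul_right]
      refine tsum_congr fun a => ?_
      rw [← ENNReal.tsum_mul_left]
      refine tsum_congr fun ω => ?_
      simp [Fin.consEquiv, Fin.prod_univ_succ]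
  have e := Fintype.equivFin ι
  rw [← (Equiv.arrowCongr e.symm (Equiv.refl α)).tsum_eq]
  rw [← e.symm.prod_comp (fun i => ∑' a, f i a), ← key _ (fun i => f (e.symm i))]
  refine tsum_congr fun ω => ?_
  rw [← e.symm.prod_comp]
  simp [Equiv.arrowCongr]

/-- Independent samples, one from each `p i`. -/
def indep {ι α : Type} [Fintype ι] (p : ι → PMF α) : PMF (ι → α) :=
  ⟨fun ω => ∏ i, p i (ω i), by
    have h : ∑' ω : ι → α, ∏ i, p i (ω i) = 1 := by
      rw [tsum_pi_prod (fun i a => p i a)]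
      simp [PMF.tsum_coe]
    exact h ▸ ENNReal.summable.hasSum⟩

/-- A bit that is `true` with probability `p`.  Numbers outside `[0, 1]`, which do not occur as Born
probabilities of density matrices, are replaced by the nearest end point. -/
def coin (p : ℝ) : PMF Bool :=
  PMF.ofFintype
    (fun b => ENNReal.ofReal (if b = true then max 0 (min p 1) else 1 - max 0 (min p 1)))
    (by
      have h0 : (0 : ℝ) ≤ max 0 (min p 1) := le_max_left _ _
      have h1 : max 0 (min p 1) ≤ 1 := max_le zero_le_one (min_le_right _ _)
      simp only [Fintype.sum_bool, if_true, Bool.false_eq_true, if_false]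
      rw [← ENNReal.ofReal_add h0 (sub_nonneg.2 h1)]
      simp)

/-! ### Tomography -/

/-- The squared Frobenius norm. -/
def frobSq {W : Type} [Fintype W] [DecidableEq W] (A : Op W) : ℝ := ∑ a, ∑ b, ‖A a b‖ ^ 2

/-- The one-qubit Pauli matrices `I, X, Y, Z`. -/
def pauli₁ : Fin 4 → Bool → Bool → ℂ
  | 0, a, b => if a = b then 1 else 0
  | 1, a, b => if a = b then 0 else 1
  | 2, a, b => if a = b then 0 else if b = true then -Complex.I else Complex.I
  | 3, a, b => if a = b then (if a = true then -1 else 1) else 0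

/-- The `n`-qubit Pauli matrix `P_{p 1} ⊗ ⋯ ⊗ P_{p n}`. -/
def pauli {n : ℕ} (p : Fin n → Fin 4) : Op (Fin n) :=
  Matrix.of fun a b => ∏ i, pauli₁ (p i) (a i) (b i)

/-- Measuring the observable `P_p` on one copy of `ρ`; the outcome `true` stands for the eigenvalue
`+1`, with projector `(1 + P_p) / 2`, and `false` for `-1`. -/
def measurePauli {n : ℕ} (ρ : Op (Fin n)) (p : Fin n → Fin 4) : PMF Bool :=
  coin (((2 : ℂ)⁻¹ • (1 + pauli p) * ρ).trace.re)

/-- The estimate `2⁻ⁿ ∑_p m_p P_p`, where `m_p` is the average of the `s` outcomes (each `±1`) for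
the observable `P_p`.  Its entries are Gaussian rationals, so it is a classical string. -/
def pauliEstimate {n s : ℕ} (ω : (Fin n → Fin 4) × Fin s → Bool) : Op (Fin n) :=
  ((2 : ℂ) ^ n)⁻¹ • ∑ p : Fin n → Fin 4,
    ((∑ j : Fin s, if ω (p, j) = true then (1 : ℂ) else -1) / (s : ℂ)) • pauli p

/-- Pauli tomography: each of the `N² = 4ⁿ` Pauli observables is measured on `s` fresh copies of
the `N = 2ⁿ`-dimensional state `ρ`; this uses `s N²` copies. -/
def tomo {n : ℕ} (s : ℕ) (ρ : Op (Fin n)) : PMF (Op (Fin n)) :=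
  (indep fun c : (Fin n → Fin 4) × Fin s => measurePauli ρ c.1).map pauliEstimate

/-- The estimates within squared Frobenius distance `r` of more than half of all estimates. -/
def central {n l : ℕ} (r : ℝ) (E : Fin l → Op (Fin n)) : Finset (Fin l) :=
  open Classical in
  Finset.univ.filter fun i =>
    l < 2 * (Finset.univ.filter fun j => frobSq (E j - E i) ≤ r).card

/-- The first estimate within squared Frobenius distance `r` of more than half of all estimates;
the failure symbol `none` if there is no such estimate. -/
def select {n l : ℕ} (r : ℝ) (E : Fin l → Op (Fin n)) : Option (Op (Fin n)) :=
  open Classical in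
  if h : (central r E).Nonempty then some (E ((central r E).min' h)) else none

/-- Amplified tomography: `l` independent runs of `tomo (4 s)`, of which one output is selected that
lies within squared Frobenius distance `4 N / s` of more than `l / 2` of them.  This uses
`4 s N² l` copies of `ρ`. -/
def tomoImp {n : ℕ} (s l : ℕ) (ρ : Op (Fin n)) : PMF (Option (Op (Fin n))) :=
  (indep fun _ : Fin l => tomo (4 * s) ρ).map (select (4 * ((2 : ℝ) ^ n / s)))

/-- `Tomography`: amplified tomography with `s = 2^(n + 9)`, hence with `L = 2^(3 n + 11) l` copies
of the `n`-qubit state `ρ`. -/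
def tomography {n : ℕ} (l : ℕ) (ρ : Op (Fin n)) : PMF (Option (Op (Fin n))) :=
  tomoImp (2 ^ (n + 9)) l ρ

/-- The number of single-copy measurements made by `tomography` is `2^(3 n + 11) l`. -/
theorem card_copies (n l : ℕ) :
    Fintype.card (Fin l × (Fin n → Fin 4) × Fin (4 * 2 ^ (n + 9))) = 2 ^ (3 * n + 11) * l := by
  simp only [Fintype.card_prod, Fintype.card_fin, Fintype.card_fun]
  have : (4 : ℕ) ^ n = 2 ^ (2 * n) := by rw [pow_mul]; norm_num
  rw [this, show 3 * n + 11 = 2 * n + (n + 9) + 2 by ring, pow_add, pow_add]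
  ring

/-! ### The encryption scheme -/

/-- The length `⌈log₂ l⌉` of the block index. -/
def idxLen (l : ℕ) : ℕ := Nat.clog 2 l

/-- The input length `⌈log₂ l⌉ + 1` of the generator. -/
def inLen (l : ℕ) : ℕ := idxLen l + 1

/-- The output length `⌈log₂ l⌉` of the generator. -/
def outLen (l : ℕ) : ℕ := Nat.clog 2 l

/-- The state `Φ_l(k, i, b) = G_l(k, i‖b)`. -/
def Phi (G : Generator inLen outLen) (l : ℕ) (k : Fin l → Bool) (i : Fin (idxLen l) → Bool)
    (b : Bool) : Op (Fin (outLen l)) :=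
  G.state l k (Fin.snoc (α := fun _ => Bool) i b : Fin (idxLen l + 1) → Bool)

/-- The comparison in `Verify`; a failure symbol is never accepted. -/
def close {n : ℕ} : Option (Op (Fin n)) → Option (Op (Fin n)) → Prop
  | some A, some B => frobSq (A - B) ≤ 9 / 128
  | _, _ => False

/-- `Verify((k, i, b), u)`: make a fresh tomograph of `Φ_l(k, i, b)` and compare it with `u`.  The
output `true` means `Valid`. -/
def verify (G : Generator inLen outLen) (l : ℕ) (k : Fin l → Bool) (i : Fin (idxLen l) → Bool)
    (b : Bool) (u : Option (Op (Fin (outLen l)))) : PMF Bool :=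
  open Classical in
  (tomography l (Phi G l k i b)).map fun u' => decide (close u u')

/-- The block number `i` as a string of `m` bits. -/
def bits (m i : ℕ) : Fin m → Bool := fun j => i.testBit j

/-- Ciphertexts for messages of `M` bits: `M` tomographs. -/
abbrev Ciphertext (l M : ℕ) : Type := Fin M → Option (Op (Fin (outLen l)))

/-- `Enc_l(k, x)`: the `i`-th component is a tomograph of `Φ_l(k, i, xᵢ)`. -/
def enc (G : Generator inLen outLen) (l M : ℕ) (k : Fin l → Bool) (x : Fin M → Bool) :
    PMF (Ciphertext l M) :=
  indep fun i => tomography l (Phi G l k (bits (idxLen l) i) (x i))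

/-- `Dec_l(k, ct)`: the `i`-th bit is `0` if `Verify((k, i, 0), uᵢ)` outputs `Valid`, and `1`
otherwise. -/
def dec (G : Generator inLen outLen) (l M : ℕ) (k : Fin l → Bool) (ct : Ciphertext l M) :
    PMF (Fin M → Bool) :=
  indep fun i => (verify G l k (bits (idxLen l) i) false (ct i)).map fun valid => !valid

/-- The output distribution of `Dec_l(k, Enc_l(k, x))` for a uniform key `k` of `l` bits. -/
def decEnc (G : Generator inLen outLen) (l M : ℕ) (x : Fin M → Bool) : PMF (Fin M → Bool) :=
  (PMF.uniformOfFintype (Fin l → Bool)).bind fun k => (enc G l M k x).bind fun ct => dec G l M k ct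

end PseudoOTP

end

/-! Decryption errs on a block only if tomography is inaccurate or if the key makes the two states
`Phi G l k i true` and `Phi G l k i false` too close to tell apart. A union bound over at most 2l +
1 blocks reduces the theorem to showing that both events have negligible probability.

Tomography: the Pauli matrices are an orthogonal basis, so the mean squared Frobenius error is a sum
of variances of coefficients (`expect_tomo_le`). Markov's inequality makes one run inaccurate with
probability at most 1/4. Among l runs the majority is accurate outside an event of probability
(√3/2)^l, and any estimate close to a majority is then close to the state (`prob_tomography_le`).

Closeness of the states: the squared distance of ρ and σ is tr ρ² + tr σ² - 2 tr ρσ, so two nearby,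
nearly pure states have overlap above 1/2. Hence the probability of confusion is bounded by the
average impurities and by 4^m times the average of (tr ρσ)^(2m), for every m
(`one_le_of_confusable`). Purities and overlap moments are, by Parseval, combinations of products of
Pauli expectations. Such a product is read off from the acceptance probability of a small circuit
that computes the parity of Pauli outcomes, so the PRFS assumption replaces it by its Haar value up
to a negligible error. The combinations have polynomially many terms since N = 2^⌈log l⌉ is O(l),
and the total error stays negligible.

For Haar states the purity is 1, and the overlap exceeds N^(-1/2) only with probability of order
exp(-√N/4) (`haar_cap_le`), so the 2m-th moment is at most l^(-m) plus a negligible term. In this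
polynomial dimension each fixed moment gives only an inverse polynomial bound. But the probability
of confusion does not depend on m, and letting m vary makes it negligible
(`exists_negligible_confusable`). -/

noncomputable section

namespace PseudoOTP

/-! ### Tensor products of one-qubit operators -/

section Tensor

variable {W : Type} [Fintype W]

/-- The tensor product of one-qubit operators. -/
def tensorOp (f : W → Matrix Bool Bool ℂ) : Op W :=
  Matrix.of fun a b => ∏ w, f w (a w) (b w)

theorem tensorOp_apply (f : W → Matrix Bool Bool ℂ) (a b : W → Bool) :
    tensorOp f a b = ∏ w, f w (a w) (b w) := rfl

theorem tensorOp_mul [DecidableEq W] (f g : W → Matrix Bool Bool ℂ) :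
    tensorOp f * tensorOp g = tensorOp fun w => f w * g w := by
  ext a b
  simp only [Matrix.mul_apply, tensorOp_apply, ← Finset.prod_mul_distrib]
  rw [Finset.prod_univ_sum, Fintype.piFinset_univ]

theorem tensorOp_one : tensorOp (fun _ : W => (1 : Matrix Bool Bool ℂ)) = 1 := by
  ext a b
  simp only [tensorOp_apply, Matrix.one_apply]
  rw [Fintype.prod_boole]
  simp [funext_iff]

theorem tensorOp_conjTranspose (f : W → Matrix Bool Bool ℂ) :
    (tensorOp f)ᴴ = tensorOp fun w => (f w)ᴴ := by
  ext a b
  simp [tensorOp_apply, Matrix.conjTranspose_apply]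

theorem trace_tensorOp [DecidableEq W] (f : W → Matrix Bool Bool ℂ) :
    (tensorOp f).trace = ∏ w, (f w).trace := by
  simp only [Matrix.trace, Matrix.diag, tensorOp_apply]
  rw [Finset.prod_univ_sum, Fintype.piFinset_univ]

/-- The operator which is `A` on the wire `i` and the identity elsewhere. -/
theorem tensorOp_update_one_apply [DecidableEq W] (i : W) (A : Matrix Bool Bool ℂ) (a b : W → Bool) :
    tensorOp (Function.update (fun _ => 1) i A) a b =
      if ∀ j, j ≠ i → a j = b j then A (a i) (b i) else 0 := by
  rw [tensorOp_apply, ← Finset.mul_prod_erase _ _ (Finset.mem_univ i)]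
  have h : ∏ w ∈ Finset.univ.erase i,
      (Function.update (fun _ => (1 : Matrix Bool Bool ℂ)) i A) w (a w) (b w) =
        ∏ w ∈ Finset.univ.erase i, if a w = b w then (1 : ℂ) else 0 := by
    refine Finset.prod_congr rfl fun w hw => ?_
    rw [Function.update_of_ne (Finset.ne_of_mem_erase hw), Matrix.one_apply]
  rw [h, Finset.prod_boole]
  simp

end Tensor

/-! ### Pauli matrices -/

/-- The one-qubit Pauli matrices. -/
def pauliMat (c : Fin 4) : Matrix Bool Bool ℂ := Matrix.of (pauli₁ c)

theorem pauli_eq_tensorOp {n : ℕ} (p : Fin n → Fin 4) :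
    pauli p = tensorOp fun i => pauliMat (p i) := rfl

theorem sum_pauli₁_mul (a b c d : Bool) :
    ∑ p, pauli₁ p a b * pauli₁ p c d = if a = d ∧ b = c then 2 else 0 := by
  cases a <;> cases b <;> cases c <;> cases d <;>
    simp [Fin.sum_univ_four, pauli₁] <;> norm_num

theorem pauliMat_conjTranspose (c : Fin 4) : (pauliMat c)ᴴ = pauliMat c := by
  ext a b
  fin_cases c <;> cases a <;> cases b <;> simp [pauliMat, pauli₁, Matrix.conjTranspose_apply]

theorem pauliMat_mul_self (c : Fin 4) : pauliMat c * pauliMat c = 1 := by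
  ext a b
  fin_cases c <;> cases a <;> cases b <;> simp [pauliMat, pauli₁, Matrix.mul_apply]

theorem pauliMat_zero : pauliMat 0 = 1 := by
  ext a b
  simp [pauliMat, pauli₁, Matrix.one_apply]

theorem trace_pauliMat_mul (c d : Fin 4) :
    (pauliMat c * pauliMat d).trace = if c = d then 2 else 0 := by
  fin_cases c <;> fin_cases d <;>
    simp [pauliMat, pauli₁, Matrix.trace, Matrix.mul_apply] <;> norm_num

/-- Completeness relation: the sum of P ⊗ P over all Pauli strings is 2^n times the swap operator.
It factors over the qubits into the one-qubit case. Parseval's identity and the Pauli expansion both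
follow from it. -/
theorem sum_pauli_mul {n : ℕ} (a b c d : Fin n → Bool) :
    ∑ p : Fin n → Fin 4, pauli p a b * pauli p c d = if a = d ∧ b = c then 2 ^ n else 0 := by
  have h : ∀ p : Fin n → Fin 4, pauli p a b * pauli p c d =
      ∏ i, pauli₁ (p i) (a i) (b i) * pauli₁ (p i) (c i) (d i) := fun p => by
    simp [pauli, Finset.prod_mul_distrib]
  simp only [h]
  rw [← Fintype.piFinset_univ, ← Finset.prod_univ_sum (fun _ : Fin n => Finset.univ)
    (fun i q => pauli₁ q (a i) (b i) * pauli₁ q (c i) (d i))]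
  simp only [sum_pauli₁_mul]
  split_ifs with hh
  · obtain ⟨rfl, rfl⟩ := hh
    simp
  · simp only [funext_iff, ← forall_and, not_forall] at hh
    obtain ⟨i, hi⟩ := hh
    exact Finset.prod_eq_zero (Finset.mem_univ i) (if_neg hi)

theorem pauli_conjTranspose {n : ℕ} (p : Fin n → Fin 4) : (pauli p)ᴴ = pauli p := by
  simp only [pauli_eq_tensorOp, tensorOp_conjTranspose, pauliMat_conjTranspose]

theorem pauli_mul_self {n : ℕ} (p : Fin n → Fin 4) : pauli p * pauli p = 1 := by
  simp only [pauli_eq_tensorOp, tensorOp_mul, pauliMat_mul_self, tensorOp_one]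

theorem pauli_zero {n : ℕ} : pauli (fun _ : Fin n => 0) = 1 := by
  simp only [pauli_eq_tensorOp, pauliMat_zero, tensorOp_one]

theorem trace_pauli_mul {n : ℕ} (p q : Fin n → Fin 4) :
    (pauli p * pauli q).trace = if p = q then 2 ^ n else 0 := by
  simp only [pauli_eq_tensorOp, tensorOp_mul, trace_tensorOp, trace_pauliMat_mul]
  split_ifs with h
  · subst h; simp
  · obtain ⟨i, hi⟩ := Function.ne_iff.1 h
    exact Finset.prod_eq_zero (Finset.mem_univ i) (if_neg hi)

/-- Parseval's identity for the Pauli basis. -/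
theorem sum_trace_pauli_mul {n : ℕ} (A B : Op (Fin n)) :
    ∑ p : Fin n → Fin 4, (pauli p * A).trace * (pauli p * B).trace = 2 ^ n * (A * B).trace := by
  have h : ∀ p : Fin n → Fin 4, (pauli p * A).trace * (pauli p * B).trace =
      ∑ a, ∑ b, ∑ c, ∑ d, (pauli p a b * pauli p c d) * (B b a * A d c) := fun p => by
    simp only [Matrix.trace, Matrix.diag, Matrix.mul_apply, Finset.sum_mul, Finset.mul_sum]
    refine Finset.sum_congr rfl fun a _ => Finset.sum_congr rfl fun b _ =>
      Finset.sum_congr rfl fun c _ => Finset.sum_congr rfl fun d _ => by ring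
  simp only [h]
  rw [Finset.sum_comm]
  simp_rw [Finset.sum_comm (s := (Finset.univ : Finset (Fin n → Fin 4))), ← Finset.sum_mul,
    sum_pauli_mul, ite_mul, zero_mul, ite_and]
  simp only [Matrix.trace, Matrix.diag, Matrix.mul_apply, Finset.mul_sum]
  refine Finset.sum_congr rfl fun b _ => Finset.sum_congr rfl fun a _ => ?_
  rw [Finset.sum_comm]
  simp [mul_comm]

theorem sum_trace_pauli_smul {n : ℕ} (A : Op (Fin n)) :
    ((2 : ℂ) ^ n)⁻¹ • ∑ p : Fin n → Fin 4, (pauli p * A).trace • pauli p = A := by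
  ext a b
  have h : ∀ p : Fin n → Fin 4, (pauli p * A).trace * pauli p a b =
      ∑ c, ∑ d, (pauli p c d * pauli p a b) * A d c := fun p => by
    simp only [Matrix.trace, Matrix.diag, Matrix.mul_apply, Finset.sum_mul]
    refine Finset.sum_congr rfl fun c _ => Finset.sum_congr rfl fun d _ => by ring
  simp only [Matrix.smul_apply, Matrix.sum_apply, smul_eq_mul, h]
  simp_rw [Finset.sum_comm (s := (Finset.univ : Finset (Fin n → Fin 4))), ← Finset.sum_mul,
    sum_pauli_mul, ite_mul, zero_mul, ite_and]
  rw [Finset.sum_comm]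
  simp

/-! ### The Frobenius norm -/

section Frobenius

variable {W : Type} [Fintype W] [DecidableEq W]

theorem frobSq_eq_trace (A : Op W) : (frobSq A : ℂ) = (A * Aᴴ).trace := by
  simp only [frobSq, Matrix.trace, Matrix.diag, Matrix.mul_apply, Matrix.conjTranspose_apply,
    Complex.ofReal_sum]
  refine Finset.sum_congr rfl fun a _ => Finset.sum_congr rfl fun b _ => ?_
  rw [RCLike.star_def, Complex.mul_conj, Complex.normSq_eq_norm_sq]

theorem frobSq_nonneg (A : Op W) : 0 ≤ frobSq A :=
  Finset.sum_nonneg fun _ _ => Finset.sum_nonneg fun _ _ => by positivity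

theorem frobSq_neg (A : Op W) : frobSq (-A) = frobSq A := by
  simp [frobSq]

theorem frobSq_sub_comm (A B : Op W) : frobSq (A - B) = frobSq (B - A) := by
  rw [← frobSq_neg, neg_sub]

/-- The square root of `frobSq` is Mathlib's Frobenius norm, whose triangle inequality applies. -/
theorem sqrt_frobSq_add_le (A B : Op W) :
    √(frobSq (A + B)) ≤ √(frobSq A) + √(frobSq B) := by
  let := Matrix.frobeniusNormedAddCommGroup (m := W → Bool) (n := W → Bool) (α := ℂ)
  have h : ∀ C : Op W, √(frobSq C) = ‖C‖ := fun C => by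
    rw [Matrix.frobenius_norm_def, Real.sqrt_eq_rpow, frobSq]
    simp
  simp only [h]
  exact norm_add_le A B

theorem sqrt_frobSq_sub_le (A B C : Op W) :
    √(frobSq (A - C)) ≤ √(frobSq (A - B)) + √(frobSq (B - C)) := by
  simpa using sqrt_frobSq_add_le (A - B) (B - C)

/-- Orthogonality of the Pauli matrices kills the cross terms, so an error in Frobenius norm is
controlled coefficient by coefficient. -/
theorem frobSq_sum_pauli {n : ℕ} (c : (Fin n → Fin 4) → ℝ) :
    frobSq (((2 : ℂ) ^ n)⁻¹ • ∑ p, (c p : ℂ) • pauli p) = (2 ^ n)⁻¹ * ∑ p, c p ^ 2 := by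
  apply Complex.ofReal_injective
  rw [frobSq_eq_trace]
  simp only [Matrix.conjTranspose_smul, Matrix.conjTranspose_sum, pauli_conjTranspose,
    Matrix.smul_mul, Matrix.mul_smul, Matrix.trace_smul, Finset.sum_mul, Finset.mul_sum,
    Matrix.trace_sum, trace_pauli_mul, smul_eq_mul]
  push_cast
  refine Finset.sum_congr rfl fun p _ => ?_
  simp
  field_simp

end Frobenius

/-! ### Expectations -/

section Expect

variable {α β ι : Type}

/-- The expectation of a function with values in `[0, ∞]`. -/
def expect (p : PMF α) (f : α → ENNReal) : ENNReal := ∑' a, p a * f a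

/-- The probability of an event. -/
def prob (p : PMF α) (S : α → Prop) : ENNReal :=
  open Classical in expect p fun a => if S a then 1 else 0

theorem expect_mono {p : PMF α} {f g : α → ENNReal} (h : ∀ a, f a ≤ g a) :
    expect p f ≤ expect p g :=
  ENNReal.tsum_le_tsum fun a => mul_le_mul_right (h a) _

theorem expect_add (p : PMF α) (f g : α → ENNReal) :
    expect p (fun a => f a + g a) = expect p f + expect p g := by
  simp only [expect, mul_add, ENNReal.tsum_add]

theorem expect_sum (p : PMF α) (s : Finset ι) (f : ι → α → ENNReal) :
    expect p (fun a => ∑ i ∈ s, f i a) = ∑ i ∈ s, expect p (f i) := by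
  simp only [expect, Finset.mul_sum]
  exact Summable.tsum_finsetSum fun _ _ => ENNReal.summable

theorem expect_const (p : PMF α) (c : ENNReal) : expect p (fun _ => c) = c := by
  simp [expect, ENNReal.tsum_mul_right]

theorem expect_const_mul (p : PMF α) (c : ENNReal) (f : α → ENNReal) :
    expect p (fun a => c * f a) = c * expect p f := by
  simp only [expect, ← ENNReal.tsum_mul_left]
  exact tsum_congr fun a => by ring

theorem expect_pure (a : α) (f : α → ENNReal) : expect (PMF.pure a) f = f a := by
  rw [expect, tsum_eq_single a]
  · simp
  · intro b hb
    simp [hb]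

theorem expect_bind (p : PMF α) (q : α → PMF β) (f : β → ENNReal) :
    expect (p.bind q) f = expect p fun a => expect (q a) f := by
  simp only [expect, PMF.bind_apply, ← ENNReal.tsum_mul_left, ← ENNReal.tsum_mul_right]
  rw [ENNReal.tsum_comm]
  exact tsum_congr fun a => tsum_congr fun b => by ring

theorem expect_map (p : PMF α) (g : α → β) (f : β → ENNReal) :
    expect (p.map g) f = expect p fun a => f (g a) := by
  rw [PMF.map, expect_bind]
  simp [expect_pure]

theorem indep_apply [Fintype ι] (p : ι → PMF α) (ω : ι → α) : indep p ω = ∏ i, p i (ω i) := rfl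

theorem expect_indep_prod [Fintype ι] (p : ι → PMF α) (f : ι → α → ENNReal) :
    expect (indep p) (fun ω => ∏ i, f i (ω i)) = ∏ i, expect (p i) (f i) := by
  simp only [expect, indep_apply, ← Finset.prod_mul_distrib]
  exact tsum_pi_prod fun i a => p i a * f i a

/-- The product formula with all factors but one equal to 1 computes the marginals of `indep`. -/
theorem expect_indep_eval [Fintype ι] (p : ι → PMF α) (i : ι) (f : α → ENNReal) :
    expect (indep p) (fun ω => f (ω i)) = expect (p i) f := by
  classical
  have h := expect_indep_prod p (Function.update (fun _ _ => 1) i f)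
  rw [← Finset.mul_prod_erase _ _ (Finset.mem_univ i), Finset.prod_eq_one, mul_one,
    Function.update_self] at h
  · rw [← h]
    congr 1
    funext ω
    rw [← Finset.mul_prod_erase _ _ (Finset.mem_univ i), Finset.prod_eq_one, mul_one,
      Function.update_self]
    intro j hj
    rw [Function.update_of_ne (Finset.ne_of_mem_erase hj)]
  · intro j hj
    rw [Function.update_of_ne (Finset.ne_of_mem_erase hj), expect_const]

theorem prob_mono {p : PMF α} {S T : α → Prop} (h : ∀ a, S a → T a) : prob p S ≤ prob p T := by
  classical
  refine expect_mono fun a => ?_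
  by_cases hS : S a
  · simp [hS, h a hS]
  · simp [hS]

theorem prob_le_one (p : PMF α) (S : α → Prop) : prob p S ≤ 1 := by
  classical
  refine (expect_mono fun a => ?_).trans_eq (expect_const p 1)
  split_ifs <;> simp

theorem prob_exists_le [Fintype ι] (p : PMF α) (S : ι → α → Prop) :
    prob p (fun a => ∃ i, S i a) ≤ ∑ i, prob p (S i) := by
  classical
  simp only [prob]
  rw [← expect_sum]
  refine expect_mono fun a => ?_
  split_ifs with h
  · obtain ⟨i, hi⟩ := h
    refine le_trans ?_ (Finset.single_le_sum (fun _ _ => zero_le) (Finset.mem_univ i))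
    simp [hi]
  · exact zero_le

theorem prob_map (p : PMF α) (g : α → β) (S : β → Prop) :
    prob (p.map g) S = prob p fun a => S (g a) := by
  classical
  rw [prob, expect_map, prob]

theorem prob_bind (p : PMF α) (q : α → PMF β) (S : β → Prop) :
    prob (p.bind q) S = expect p fun a => prob (q a) S := by
  classical
  rw [prob, expect_bind]; rfl

theorem prob_indep_eval [Fintype ι] (p : ι → PMF α) (i : ι) (S : α → Prop) :
    prob (indep p) (fun ω => S (ω i)) = prob (p i) S := by
  classical
  exact expect_indep_eval p i fun a => if S a then 1 else 0

theorem one_le_apply_add_prob_ne (p : PMF α) (x : α) : 1 ≤ p x + prob p (fun a => a ≠ x) := by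
  classical
  have hx : p x = expect p fun a => if a = x then 1 else 0 := by
    rw [expect, tsum_eq_single x] <;> simp +contextual
  rw [hx, prob, ← expect_add, ← expect_const p 1]
  refine expect_mono fun a => ?_
  by_cases h : a = x <;> simp [h, expect_const]

/-- The expectation of a nonnegative function of independent bits as a finite sum. -/
theorem expect_ofReal [Fintype α] (p : PMF α) (F : α → ℝ) (hF : ∀ a, 0 ≤ F a) :
    expect p (fun a => ENNReal.ofReal (F a)) = ENNReal.ofReal (∑ a, (p a).toReal * F a) := by
  rw [expect, tsum_fintype, ENNReal.ofReal_sum_of_nonneg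
    fun a _ => mul_nonneg ENNReal.toReal_nonneg (hF a)]
  refine Finset.sum_congr rfl fun a _ => ?_
  rw [ENNReal.ofReal_mul ENNReal.toReal_nonneg, ENNReal.ofReal_toReal (p.apply_ne_top a)]

theorem sum_toReal_apply [Fintype α] (p : PMF α) : ∑ a, (p a).toReal = 1 := by
  rw [← ENNReal.toReal_sum fun a _ => p.apply_ne_top a, ← tsum_fintype (L := .unconditional _),
    p.tsum_coe, ENNReal.toReal_one]

end Expect

/-! ### Sums of independent centered random variables -/

section Variance

variable {α ι : Type} [Fintype α] [Fintype ι] [DecidableEq ι]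

/-- For i ≠ j the sum factors over the coordinates, and the factor at i is a mean, which vanishes.
-/
theorem sum_prod_mul_mul (w : ι → α → ℝ) (hw : ∀ i, ∑ b, w i b = 1) (y : ι → α → ℝ)
    (hy : ∀ i, ∑ b, w i b * y i b = 0) (i j : ι) :
    ∑ ω : ι → α, (∏ k, w k (ω k)) * (y i (ω i) * y j (ω j)) =
      if i = j then ∑ b, w i b * y i b ^ 2 else 0 := by
  have h : ∀ ω : ι → α, (∏ k, w k (ω k)) * (y i (ω i) * y j (ω j)) =
      ∏ k, w k (ω k) * ((if k = i then y k (ω k) else 1) * (if k = j then y k (ω k) else 1)) := by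
    intro ω
    rw [Finset.prod_mul_distrib, Finset.prod_mul_distrib, Finset.prod_ite_eq', Finset.prod_ite_eq',
      if_pos (Finset.mem_univ i), if_pos (Finset.mem_univ j)]
  simp only [h]
  rw [← Fintype.piFinset_univ, ← Finset.prod_univ_sum (fun _ : ι => Finset.univ)
    (fun k b => w k b * ((if k = i then y k b else 1) * (if k = j then y k b else 1)))]
  split_ifs with hij
  · subst hij
    rw [← Finset.mul_prod_erase _ _ (Finset.mem_univ i), Finset.prod_eq_one, mul_one]
    · simp [sq]
    · intro k hk
      simp [Finset.ne_of_mem_erase hk, hw]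
  · refine Finset.prod_eq_zero (Finset.mem_univ i) ?_
    simp [hij, hy]

/-- Variances of uncorrelated variables add. The subset `S` is needed because each Pauli coefficient
involves only its own share of the outcomes. -/
theorem sum_prod_mul_sq_sum_le (w : ι → α → ℝ) (hw : ∀ i, ∑ b, w i b = 1)
    (y : ι → α → ℝ) (hy : ∀ i, ∑ b, w i b * y i b = 0)
    (hy2 : ∀ i, ∑ b, w i b * y i b ^ 2 ≤ 1) (S : Finset ι) :
    ∑ ω : ι → α, (∏ k, w k (ω k)) * (∑ i ∈ S, y i (ω i)) ^ 2 ≤ S.card := by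
  have h : ∀ ω : ι → α, (∏ k, w k (ω k)) * (∑ i ∈ S, y i (ω i)) ^ 2 =
      ∑ i ∈ S, ∑ j ∈ S, (∏ k, w k (ω k)) * (y i (ω i) * y j (ω j)) := by
    intro ω
    rw [sq, Finset.sum_mul_sum, Finset.mul_sum]
    exact Finset.sum_congr rfl fun i _ => Finset.mul_sum _ _ _
  simp only [h]
  rw [Finset.sum_comm]
  refine (Finset.sum_le_card_nsmul S _ 1 fun i hi => ?_).trans (by simp)
  rw [Finset.sum_comm]
  simp only [sum_prod_mul_mul w hw y hy]
  rw [Finset.sum_ite_eq, if_pos hi]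
  exact hy2 i

end Variance

/-! ### Measuring Pauli observables -/

section Born

variable {n : ℕ} {ρ : Op (Fin n)}

/-- The expectation of a Pauli observable. -/
def pauliMean (ρ : Op (Fin n)) (p : Fin n → Fin 4) : ℝ := (pauli p * ρ).trace.re

theorem coe_pauliMean (hρ : ρ.IsHermitian) (p : Fin n → Fin 4) :
    (pauliMean ρ p : ℂ) = (pauli p * ρ).trace := by
  rw [pauliMean, ← Complex.conj_eq_iff_re, ← RCLike.star_def, ← Matrix.trace_conjTranspose,
    Matrix.conjTranspose_mul, pauli_conjTranspose, hρ.eq, Matrix.trace_mul_comm]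

theorem trace_mul_self_mul_re_nonneg {W : Type} [Fintype W] [DecidableEq W] {σ : Op W}
    (hσ : σ.PosSemidef) {A : Op W} (hA : Aᴴ = A) : 0 ≤ (A * A * σ).trace.re := by
  have h := (hσ.mul_mul_conjTranspose_same A).trace_nonneg
  rw [hA, Matrix.trace_mul_comm, ← Matrix.mul_assoc] at h
  exact (Complex.le_def.1 h).1

/-- Since P² = 1, the operators 1 ± P are half their own squares, so their expectations in ρ are
nonnegative. -/
theorem abs_pauliMean_le_one (hρ : IsDensity ρ) (p : Fin n → Fin 4) : |pauliMean ρ p| ≤ 1 := by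
  have h1 := trace_mul_self_mul_re_nonneg hρ.1 (A := 1 + pauli p)
    (by simp [pauli_conjTranspose])
  have h2 := trace_mul_self_mul_re_nonneg hρ.1 (A := 1 - pauli p)
    (by simp [pauli_conjTranspose])
  have e1 : (1 + pauli p) * (1 + pauli p) * ρ = (2 : ℂ) • ρ + (2 : ℂ) • (pauli p * ρ) := by
    have : (1 + pauli p) * (1 + pauli p) = (2 : ℂ) • (1 + pauli p) := by
      rw [mul_add, add_mul, add_mul, pauli_mul_self, two_smul]; simp; abel
    rw [this, Matrix.smul_mul, add_mul, one_mul, smul_add]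
  have e2 : (1 - pauli p) * (1 - pauli p) * ρ = (2 : ℂ) • ρ - (2 : ℂ) • (pauli p * ρ) := by
    have : (1 - pauli p) * (1 - pauli p) = (2 : ℂ) • (1 - pauli p) := by
      rw [mul_sub, sub_mul, sub_mul, pauli_mul_self, two_smul]; simp; abel
    rw [this, Matrix.smul_mul, sub_mul, one_mul, smul_sub]
  rw [e1, Matrix.trace_add, Matrix.trace_smul, Matrix.trace_smul, hρ.2] at h1
  rw [e2, Matrix.trace_sub, Matrix.trace_smul, Matrix.trace_smul, hρ.2] at h2
  simp at h1 h2
  rw [abs_le, pauliMean]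
  constructor <;> linarith

/-- The bound on the mean puts the Born probability in [0, 1], where the clamping in `coin` has no
effect. -/
theorem measurePauli_apply_toReal (hρ : IsDensity ρ) (p : Fin n → Fin 4) (b : Bool) :
    (measurePauli ρ p b).toReal = (1 + (if b = true then 1 else -1) * pauliMean ρ p) / 2 := by
  have h := abs_le.1 (abs_pauliMean_le_one hρ p)
  have e : ((2 : ℂ)⁻¹ • (1 + pauli p) * ρ).trace.re = (1 + pauliMean ρ p) / 2 := by
    rw [Matrix.smul_mul, add_mul, one_mul, Matrix.trace_smul, Matrix.trace_add, hρ.2, pauliMean,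
      smul_eq_mul, show (2 : ℂ)⁻¹ = ((2⁻¹ : ℝ) : ℂ) by norm_num, Complex.re_ofReal_mul]
    simp
    ring
  rw [measurePauli, e, coin, PMF.ofFintype_apply, min_eq_left (by linarith),
    max_eq_right (by linarith), ENNReal.toReal_ofReal]
  · cases b <;> simp
    ring
  · split_ifs <;> linarith

theorem sum_measurePauli_mul_sub (hρ : IsDensity ρ) (p : Fin n → Fin 4) :
    ∑ b, (measurePauli ρ p b).toReal * ((if b = true then 1 else -1) - pauliMean ρ p) = 0 := by
  simp only [measurePauli_apply_toReal hρ, Fintype.sum_bool]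
  simp
  ring

theorem sum_measurePauli_mul_sub_sq_le (hρ : IsDensity ρ) (p : Fin n → Fin 4) :
    ∑ b, (measurePauli ρ p b).toReal * ((if b = true then 1 else -1) - pauliMean ρ p) ^ 2 ≤ 1 := by
  simp only [measurePauli_apply_toReal hρ, Fintype.sum_bool]
  simp
  nlinarith [sq_nonneg (pauliMean ρ p)]

end Born

/-! ### Accuracy of Pauli tomography -/

/-- Markov's inequality. -/
theorem prob_lt_le {α : Type} (p : PMF α) (F : α → ℝ) {r c : ℝ} (hr : 0 < r)
    (h : expect p (fun a => ENNReal.ofReal (F a)) ≤ ENNReal.ofReal c) :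
    prob p (fun a => r < F a) ≤ ENNReal.ofReal (c / r) := by
  classical
  have h1 : prob p (fun a => r < F a) ≤
      expect p fun a => ENNReal.ofReal r⁻¹ * ENNReal.ofReal (F a) := by
    refine expect_mono fun a => ?_
    split_ifs with ha
    · rw [← ENNReal.ofReal_mul (by positivity), ← ENNReal.ofReal_one]
      refine ENNReal.ofReal_le_ofReal ?_
      rw [inv_mul_eq_div, le_div_iff₀ hr]
      linarith
    · exact zero_le
  rw [expect_const_mul] at h1
  refine h1.trans ((mul_le_mul_right h _).trans_eq ?_)
  rw [← ENNReal.ofReal_mul (by positivity), inv_mul_eq_div]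

theorem pauliEstimate_sub {n s : ℕ} (hs : 0 < s) {ρ : Op (Fin n)} (hρ : ρ.IsHermitian)
    (ω : (Fin n → Fin 4) × Fin s → Bool) :
    pauliEstimate ω - ρ = ((2 : ℂ) ^ n)⁻¹ • ∑ p : Fin n → Fin 4,
      (((∑ j : Fin s, ((if ω (p, j) = true then 1 else -1) - pauliMean ρ p)) / s : ℝ) : ℂ) •
        pauli p := by
  have hs' : (s : ℂ) ≠ 0 := by exact_mod_cast hs.ne'
  conv_lhs => rw [← sum_trace_pauli_smul ρ]
  rw [pauliEstimate, ← smul_sub, ← Finset.sum_sub_distrib]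
  congr 1
  refine Finset.sum_congr rfl fun p _ => ?_
  rw [← sub_smul, ← coe_pauliMean hρ, Finset.sum_sub_distrib]
  congr 1
  push_cast
  rw [Finset.sum_const, Finset.card_univ, Fintype.card_fin, nsmul_eq_mul, sub_div,
    mul_div_cancel_left₀ _ hs']
  congr 2
  exact Finset.sum_congr rfl fun j _ => by split_ifs <;> simp

/-- Each of the N² coefficients is an average of s independent outcomes of variance at most 1, hence
has variance at most 1/s; the normalization contributes 1/N. -/
theorem expect_tomo_le {n s : ℕ} (hs : 0 < s) {ρ : Op (Fin n)} (hρ : IsDensity ρ) :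
    expect (tomo s ρ) (fun A => ENNReal.ofReal (frobSq (A - ρ))) ≤
      ENNReal.ofReal (2 ^ n / s) := by
  have hs' : (0 : ℝ) < s := by exact_mod_cast hs
  set y : (Fin n → Fin 4) × Fin s → Bool → ℝ :=
    fun c b => (if b = true then 1 else -1) - pauliMean ρ c.1 with hy
  set w : (Fin n → Fin 4) × Fin s → Bool → ℝ := fun c b => (measurePauli ρ c.1 b).toReal with hw
  rw [tomo, expect_map, expect_ofReal _ _ fun ω => frobSq_nonneg _]
  refine ENNReal.ofReal_le_ofReal ?_
  have h1 : ∀ ω : (Fin n → Fin 4) × Fin s → Bool,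
      (indep (fun c : (Fin n → Fin 4) × Fin s => measurePauli ρ c.1) ω).toReal *
        frobSq (pauliEstimate ω - ρ) =
      ∑ p, ((2 ^ n)⁻¹ * ((s : ℝ) ^ 2)⁻¹) *
        ((∏ c, w c (ω c)) * (∑ c ∈ ({p} : Finset (Fin n → Fin 4)) ×ˢ (Finset.univ : Finset (Fin s)),
          y c (ω c)) ^ 2) := by
    intro ω
    rw [pauliEstimate_sub hs hρ.1.isHermitian, frobSq_sum_pauli, indep_apply, ENNReal.toReal_prod,
      Finset.mul_sum, Finset.mul_sum]
    refine Finset.sum_congr rfl fun p _ => ?_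
    rw [Finset.sum_product, Finset.sum_singleton]
    simp only [hy, hw]
    field_simp
  simp only [h1]
  rw [Finset.sum_comm]
  simp only [← Finset.mul_sum]
  have h2 : ∀ p : Fin n → Fin 4,
      ∑ ω : (Fin n → Fin 4) × Fin s → Bool, (∏ c, w c (ω c)) *
        (∑ c ∈ ({p} : Finset (Fin n → Fin 4)) ×ˢ (Finset.univ : Finset (Fin s)), y c (ω c)) ^ 2 ≤
          s := by
    intro p
    refine (sum_prod_mul_sq_sum_le w (fun c => sum_toReal_apply _) y
      (fun c => sum_measurePauli_mul_sub hρ c.1)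
      (fun c => sum_measurePauli_mul_sub_sq_le hρ c.1) _).trans_eq ?_
    simp
  refine (mul_le_mul_of_nonneg_left (Finset.sum_le_sum fun p _ => h2 p) (by positivity)).trans_eq ?_
  simp only [Finset.sum_const, Finset.card_univ, Fintype.card_fun, Fintype.card_fin, nsmul_eq_mul]
  push_cast
  rw [show (4 : ℝ) ^ n = 2 ^ n * 2 ^ n by rw [← mul_pow]; norm_num]
  field_simp

/-- The fourfold number of samples is what turns Markov's bound into 1/4. -/
theorem prob_tomo_le {n s : ℕ} (hs : 0 < s) {ρ : Op (Fin n)} (hρ : IsDensity ρ) :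
    prob (tomo (4 * s) ρ) (fun A => 2 ^ n / (s : ℝ) < frobSq (A - ρ)) ≤ ENNReal.ofReal 4⁻¹ := by
  have hs' : (0 : ℝ) < s := by exact_mod_cast hs
  refine (prob_lt_le _ _ (by positivity) (expect_tomo_le (by positivity) hρ)).trans_eq ?_
  congr 1
  push_cast
  field_simp

/-! ### Amplification by majority -/

/-- Triangle inequality for squared distances: radii measured in units of √r add. -/
theorem frobSq_sub_le_of_le {n : ℕ} {A B C : Op (Fin n)} {a b r : ℝ} (hr : 0 ≤ r) (ha : 0 ≤ a)
    (hb : 0 ≤ b) (h1 : frobSq (A - B) ≤ a ^ 2 * r) (h2 : frobSq (B - C) ≤ b ^ 2 * r) :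
    frobSq (A - C) ≤ (a + b) ^ 2 * r := by
  have h := sqrt_frobSq_sub_le A B C
  have h1' : √(frobSq (A - B)) ≤ a * √r :=
    (Real.sqrt_le_sqrt h1).trans_eq (by rw [Real.sqrt_mul (sq_nonneg a), Real.sqrt_sq ha])
  have h2' : √(frobSq (B - C)) ≤ b * √r :=
    (Real.sqrt_le_sqrt h2).trans_eq (by rw [Real.sqrt_mul (sq_nonneg b), Real.sqrt_sq hb])
  have h3 : √(frobSq (A - C)) ≤ (a + b) * √r := by linarith
  rw [Real.sqrt_le_left (by positivity), mul_pow, Real.sq_sqrt hr] at h3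
  exact h3

/-- If more than half of the estimates are accurate, then so is the selected one. -/
theorem exists_select_eq {n l : ℕ} {r : ℝ} (hr : 0 ≤ r) {ρ : Op (Fin n)} {E : Fin l → Op (Fin n)}
    {S : Finset (Fin l)} (hS : ∀ i ∈ S, frobSq (E i - ρ) ≤ r) (hcard : l < 2 * S.card) :
    ∃ A, select (4 * r) E = some A ∧ frobSq (A - ρ) ≤ 9 * r := by
  classical
  have hne : S.Nonempty := Finset.card_pos.1 (by omega)
  -- Every accurate estimate is central: two points within √r of ρ are within 2√r of each other.
  have hc : (central (4 * r) E).Nonempty := by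
    obtain ⟨i, hi⟩ := hne
    refine ⟨i, ?_⟩
    simp only [central, Finset.mem_filter, Finset.mem_univ, true_and]
    refine hcard.trans_le (Nat.mul_le_mul_left 2 (Finset.card_le_card fun j hj => ?_))
    simp only [Finset.mem_filter, Finset.mem_univ, true_and]
    have h := frobSq_sub_le_of_le (a := 1) (b := 1) (A := E j) (B := ρ) (C := E i) hr
      zero_le_one zero_le_one (by simpa using hS j hj)
      (by rw [frobSq_sub_comm]; simpa using hS i hi)
    norm_num at h
    exact h
  refine ⟨E ((central (4 * r) E).min' hc), by rw [select, dif_pos hc], ?_⟩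
  have hm := Finset.min'_mem _ hc
  set i := (central (4 * r) E).min' hc
  simp only [central, Finset.mem_filter, Finset.mem_univ, true_and] at hm
  -- Two strict majorities intersect, so some accurate estimate `E j` lies within 2√r of the
  -- selected one. This places the selected one within 3√r of ρ.
  obtain ⟨j, hj⟩ : (S ∩ Finset.univ.filter fun j => frobSq (E j - E i) ≤ 4 * r).Nonempty := by
    rw [← Finset.card_pos]
    have h1 := Finset.card_union_add_card_inter S
      (Finset.univ.filter fun j => frobSq (E j - E i) ≤ 4 * r)
    have h2 := Finset.card_le_univ (S ∪ Finset.univ.filter fun j => frobSq (E j - E i) ≤ 4 * r)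
    rw [Fintype.card_fin] at h2
    have h3 : l < 2 * (Finset.univ.filter fun j => frobSq (E j - E i) ≤ 4 * r).card := by
      convert hm
    omega
  simp only [Finset.mem_inter, Finset.mem_filter, Finset.mem_univ, true_and] at hj
  have h := frobSq_sub_le_of_le (a := 2) (b := 1) (A := E i) (B := E j) (C := ρ) hr
    zero_le_two zero_le_one (by rw [frobSq_sub_comm]; norm_num; exact hj.2)
    (by simpa using hS j hj.1)
  norm_num at h
  exact h

/-- Chernoff's bound: a majority of independent events of probability at most `1/4` occurs with
exponentially small probability. -/
theorem prob_majority_le {α : Type} (p : PMF α) (l : ℕ) (bad : α → Prop) [DecidablePred bad]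
    (h : prob p bad ≤ ENNReal.ofReal 4⁻¹) :
    prob (indep fun _ : Fin l => p)
        (fun ω => ¬ l < 2 * (Finset.univ.filter fun i => ¬ bad (ω i)).card) ≤
      ENNReal.ofReal ((√3 / 2) ^ l) := by
  classical
  have h3 : (0 : ℝ) < √3 := by positivity
  have h33 : √3 * √3 = 3 := Real.mul_self_sqrt (by norm_num)
  have h31 : 1 ≤ √3 := by nlinarith
  -- Exponential moment with weight t for a bad event and 1/t for a good one. With probability 1/4
  -- of a bad event the mean t/4 + 3/(4t) is least at t = √3, where it equals √3/2.
  set g : α → ENNReal := fun a => ENNReal.ofReal (if bad a then √3 else (√3)⁻¹) with hg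
  have hgp : expect p g ≤ ENNReal.ofReal (√3 / 2) := by
    have h1 : ∀ a, g a = ENNReal.ofReal (√3)⁻¹ +
        ENNReal.ofReal (2 * (√3)⁻¹) * (if bad a then 1 else 0) := by
      intro a
      simp only [hg]
      split_ifs
      · rw [mul_one, ← ENNReal.ofReal_add (by positivity) (by positivity)]
        congr 1
        field_simp
        nlinarith
      · simp
    rw [funext h1, expect_add, expect_const, expect_const_mul]
    have h' : (expect p fun a => if bad a then (1 : ENNReal) else 0) ≤ ENNReal.ofReal 4⁻¹ := by
      refine le_trans (le_of_eq ?_) h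
      rw [prob]
      congr!
    refine (add_le_add_right (mul_le_mul_right h' _) _).trans_eq ?_
    rw [← ENNReal.ofReal_mul (by positivity), ← ENNReal.ofReal_add (by positivity) (by positivity)]
    congr 1
    field_simp
    nlinarith
  calc _ ≤ expect (indep fun _ : Fin l => p) (fun ω => ∏ i, g (ω i)) := by
        refine expect_mono fun ω => ?_
        split_ifs with hm
        · have h1 : ∏ i, g (ω i) = ENNReal.ofReal
              (√3 ^ (Finset.univ.filter fun i => bad (ω i)).card *
                (√3)⁻¹ ^ (Finset.univ.filter fun i => ¬ bad (ω i)).card) := by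
            simp only [hg]
            rw [← ENNReal.ofReal_prod_of_nonneg fun i _ => by split_ifs <;> positivity,
              Finset.prod_ite, Finset.prod_const, Finset.prod_const]
          have h2 := Finset.card_filter_add_card_filter_not (s := (Finset.univ : Finset (Fin l)))
            (fun i => bad (ω i))
          rw [Finset.card_univ, Fintype.card_fin] at h2
          rw [h1, ← ENNReal.ofReal_one]
          refine ENNReal.ofReal_le_ofReal ?_
          rw [inv_pow, ← div_eq_mul_inv, one_le_div (by positivity)]
          -- Without a good majority there are at least as many bad events as good ones, so the
          -- product of the weights is at least 1.
          refine pow_le_pow_right₀ h31 ?_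
          have h4 : (Finset.univ.filter fun i => ¬ bad (ω i)).card * 2 ≤ l := by
            have := not_lt.1 hm
            omega
          omega
        · exact zero_le
    _ = expect p g ^ l := by
        rw [expect_indep_prod (fun _ : Fin l => p) (fun _ => g)]
        simp
    _ ≤ _ := by
        rw [ENNReal.ofReal_pow (by positivity)]
        gcongr

/-- `Tomography` is accurate except with exponentially small probability. -/
theorem prob_tomography_le {n : ℕ} (l : ℕ) {ρ : Op (Fin n)} (hρ : IsDensity ρ) :
    prob (tomography l ρ) (fun u => ¬ ∃ A, u = some A ∧ frobSq (A - ρ) ≤ 9 / 512) ≤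
      ENNReal.ofReal ((√3 / 2) ^ l) := by
  classical
  rw [tomography, tomoImp, prob_map]
  refine le_trans (prob_mono fun E => ?_)
    (prob_majority_le _ l _ (prob_tomo_le (s := 2 ^ (n + 9)) (by positivity) hρ))
  contrapose!
  intro h
  have hr : (2 : ℝ) ^ n / (2 ^ (n + 9) : ℕ) = 1 / 512 := by
    push_cast
    rw [pow_add]
    field_simp
    norm_num
  obtain ⟨A, hA, hA'⟩ := exists_select_eq (r := 2 ^ n / (2 ^ (n + 9) : ℕ)) (by positivity)
    (fun i hi => by simpa using hi) h
  exact ⟨A, hA, hA'.trans_eq (by rw [hr]; norm_num)⟩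

/-! ### Failure of decryption -/

/-- Two states that `Verify` may confuse. -/
def Confusable {n : ℕ} (ρ σ : Op (Fin n)) : Prop := frobSq (ρ - σ) ≤ 9 / 32

/-- Two tomographs are involved, the one in the ciphertext and the fresh one in `verify`, and if
both are accurate the decoded bit is right. This costs the tomography error twice. -/
theorem prob_verify_le (G : Generator inLen outLen) (l : ℕ) (k : Fin l → Bool)
    (i : Fin (idxLen l) → Bool) (hG : ∀ b, IsDensity (Phi G l k i b)) (b : Bool)
    (hb : b = true → ¬ Confusable (Phi G l k i true) (Phi G l k i false)) :
    expect (tomography l (Phi G l k i b)) (fun u =>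
      prob ((verify G l k i false u).map fun valid => !valid) (fun c => c ≠ b)) ≤
        ENNReal.ofReal (2 * (√3 / 2) ^ l) := by
  classical
  set δ := ENNReal.ofReal ((√3 / 2) ^ l)
  set good : Bool → Option (Op (Fin (outLen l))) → Prop :=
    fun b u => ∃ A, u = some A ∧ frobSq (A - Phi G l k i b) ≤ 9 / 512 with hgood
  have h512 : (0 : ℝ) ≤ 1 / 512 := by norm_num
  -- In units of 1/√512 an accurate tomograph is within 3 of its state and `Verify` accepts up to 6
  -- (9/128 = 36/512). For b = 0 both tomographs belong to the same state and 3 + 3 = 6. For b = 1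
  -- acceptance would put the two states within 3 + 6 + 3 = 12, and 144/512 = 9/32 is the threshold
  -- of `Confusable`.
  have key : ∀ u u', good b u → good false u' → (!decide (close u u')) = b := by
    rintro u u' ⟨A, rfl, hA⟩ ⟨A', rfl, hA'⟩
    have h9 : (9 : ℝ) / 512 = 3 ^ 2 * (1 / 512) := by norm_num
    rw [h9] at hA hA'
    rw [frobSq_sub_comm] at hA'
    cases b with
    | false =>
      have h := frobSq_sub_le_of_le h512 zero_le_three zero_le_three hA hA'
      rw [Bool.not_eq_false', decide_eq_true_eq]
      exact h.trans (by norm_num)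
    | true =>
      rw [Bool.not_eq_true', decide_eq_false_iff_not]
      intro hc
      change frobSq (A - A') ≤ 9 / 128 at hc
      rw [show (9 : ℝ) / 128 = 6 ^ 2 * (1 / 512) by norm_num] at hc
      rw [frobSq_sub_comm] at hA hA'
      have h1 := frobSq_sub_le_of_le (b := 6) h512 zero_le_three (by norm_num) hA hc
      have h2 := frobSq_sub_le_of_le (a := 3 + 6) h512 (by norm_num) zero_le_three h1 hA'
      refine hb rfl (h2.trans ?_)
      norm_num
  have h1 : ∀ u, prob ((verify G l k i false u).map fun valid => !valid) (fun c => c ≠ b) ≤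
      (if ¬ good b u then 1 else 0) + δ := by
    intro u
    by_cases hu : good b u
    swap
    · rw [if_pos hu]
      exact (prob_le_one _ _).trans le_self_add
    · rw [if_neg (not_not.2 hu), zero_add, prob_map, verify, prob_map]
      refine le_trans (prob_mono fun u' => ?_) (prob_tomography_le l (hG false))
      contrapose!
      exact fun h => key u u' hu h
  refine (expect_mono h1).trans ?_
  rw [expect_add, expect_const, two_mul, ENNReal.ofReal_add (by positivity) (by positivity)]
  refine add_le_add_left (le_trans (le_of_eq ?_) (prob_tomography_le l (hG b))) _
  simp only [prob, hgood]
  congr!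

/-- The decryption error is at most the number of blocks times the sum of the error of tomography and
the probability that the two states of a block are confusable. -/
theorem one_sub_decEnc_le (G : Generator inLen outLen) (l M : ℕ) (x : Fin M → Bool)
    (hG : ∀ k i b, IsDensity (Phi G l k i b)) (δ : ℝ) (hδ : 0 ≤ δ)
    (h : ∀ i, prob (PMF.uniformOfFintype (Fin l → Bool))
      (fun k => Confusable (Phi G l k i true) (Phi G l k i false)) ≤ ENNReal.ofReal δ) :
    1 - M * (2 * (√3 / 2) ^ l + δ) ≤ (decEnc G l M x x).toReal := by
  classical
  have h1 : prob (decEnc G l M x) (fun y => y ≠ x) ≤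
      ENNReal.ofReal (M * (2 * (√3 / 2) ^ l + δ)) := by
    calc _ ≤ prob (decEnc G l M x) (fun y => ∃ i, y i ≠ x i) :=
          prob_mono fun y hy => Function.ne_iff.1 hy
      _ ≤ ∑ i, prob (decEnc G l M x) (fun y => y i ≠ x i) := prob_exists_le _ _
      _ ≤ ∑ i : Fin M, ENNReal.ofReal (2 * (√3 / 2) ^ l + δ) := by
          refine Finset.sum_le_sum fun i _ => ?_
          rw [decEnc, prob_bind]
          simp only [prob_bind]
          have h2 : ∀ k, (expect (enc G l M k x) fun ct => prob (dec G l M k ct) fun y => y i ≠ x i)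
              = expect (tomography l (Phi G l k (bits (idxLen l) i) (x i))) fun u =>
                prob ((verify G l k (bits (idxLen l) i) false u).map fun valid => !valid)
                  (fun c => c ≠ x i) := by
            intro k
            simp only [dec]
            rw [← expect_indep_eval
              (fun i : Fin M => tomography l (Phi G l k (bits (idxLen l) i) (x i))) i]
            simp only [enc]
            congr 1
            funext ct
            exact prob_indep_eval _ i (fun c => c ≠ x i)
          simp only [h2]
          rw [add_comm, ENNReal.ofReal_add hδ (by positivity)]
          refine le_trans ?_ (add_le_add_left (h (bits (idxLen l) i)) _)
          rw [prob, ← expect_const (PMF.uniformOfFintype (Fin l → Bool))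
            (ENNReal.ofReal (2 * (√3 / 2) ^ l)), ← expect_add]
          refine expect_mono fun k => ?_
          -- A key with confusable states is charged error probability 1; other keys are charged
          -- only the tomography error.
          split_ifs with hc
          · refine le_trans ?_ le_self_add
            refine (expect_mono fun u => prob_le_one _ _).trans_eq (expect_const _ 1)
          · rw [zero_add]
            exact prob_verify_le G l k _ (hG k _) _ fun _ => hc
      _ = _ := by
          rw [Finset.sum_const, Finset.card_univ, Fintype.card_fin, nsmul_eq_mul,
            ENNReal.ofReal_mul (by positivity), ENNReal.ofReal_natCast]
  have h2 := (one_le_apply_add_prob_ne (decEnc G l M x) x).trans (add_le_add_right h1 _)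
  have h3 := ENNReal.toReal_mono
    (ENNReal.add_ne_top.2 ⟨PMF.apply_ne_top _ _, ENNReal.ofReal_ne_top⟩) h2
  rw [ENNReal.toReal_add (PMF.apply_ne_top _ _) ENNReal.ofReal_ne_top,
    ENNReal.toReal_ofReal (by positivity), ENNReal.toReal_one] at h3
  linarith

/-! ### Circuits in the Heisenberg picture -/

section Heisenberg

variable {W : Type} [Fintype W] [DecidableEq W]

/-- The matrix of the gate `H`. -/
def hadamardMat : Matrix Bool Bool ℂ :=
  Matrix.of fun a b => (if a = true ∧ b = true then -1 else 1) * ((Real.sqrt 2)⁻¹ : ℂ)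

/-- The matrix of the gate `T`. -/
def tMat : Matrix Bool Bool ℂ :=
  Matrix.diagonal fun a => if a = true then Complex.exp (Real.pi / 4 * Complex.I) else 1

theorem toOp_H (i : W) : (Gate.H i).toOp = tensorOp (Function.update (fun _ => 1) i hadamardMat) := by
  ext a b
  rw [tensorOp_update_one_apply]
  rfl

theorem toOp_T (i : W) : (Gate.T i).toOp = tensorOp (Function.update (fun _ => 1) i tMat) := by
  ext a b
  rw [tensorOp_update_one_apply, Gate.toOp, tMat, Matrix.diagonal_apply, Matrix.diagonal_apply]
  by_cases h : a = b
  · subst h; simp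
  · rw [if_neg h]
    split_ifs with h1 h2 h3
    · refine absurd (funext fun j => ?_) h
      by_cases hj : j = i
      · rw [hj, h2]
      · exact h1 j hj
    · refine absurd (funext fun j => ?_) h
      by_cases hj : j = i
      · rw [hj, h2]
      · exact h1 j hj
    · rfl
    · rfl

theorem sqrt_two_inv_mul_self : ((Real.sqrt 2 : ℝ) : ℂ)⁻¹ * ((Real.sqrt 2 : ℝ) : ℂ)⁻¹ = 2⁻¹ := by
  rw [← mul_inv, ← Complex.ofReal_mul, Real.mul_self_sqrt (by norm_num)]
  norm_num

theorem hadamardMat_conjTranspose : hadamardMatᴴ = hadamardMat := by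
  ext a b
  cases a <;> cases b <;> simp [hadamardMat, Matrix.conjTranspose_apply]

theorem hadamardMat_mul_self : hadamardMat * hadamardMat = 1 := by
  ext a b
  cases a <;> cases b <;>
    (simp [hadamardMat, Matrix.mul_apply, sqrt_two_inv_mul_self]; try norm_num)

theorem hadamardMat_conj_Z : hadamardMatᴴ * pauliMat 3 * hadamardMat = pauliMat 1 := by
  rw [hadamardMat_conjTranspose]
  ext a b
  cases a <;> cases b <;>
    simp [hadamardMat, Matrix.mul_apply, pauliMat, pauli₁, sqrt_two_inv_mul_self] <;> norm_num

theorem exp_pi_div_four_pow_two : Complex.exp (Real.pi / 4 * Complex.I) ^ 2 = Complex.I := by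
  rw [← Complex.exp_nat_mul, show ((2 : ℕ) : ℂ) * (Real.pi / 4 * Complex.I) =
    Real.pi / 2 * Complex.I by push_cast; ring, Complex.exp_pi_div_two_mul_I]

theorem tMat_conj_mul_self : tMatᴴ * tMat = 1 := by
  rw [tMat, Matrix.diagonal_conjTranspose, Matrix.diagonal_mul_diagonal, ← Matrix.diagonal_one]
  congr 1
  funext a
  cases a
  · simp
  · simp only [Pi.star_apply, if_true, RCLike.star_def, Complex.conj_mul']
    rw [show (Real.pi / 4 * Complex.I : ℂ) = ((Real.pi / 4 : ℝ) : ℂ) * Complex.I by push_cast; ring,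
      Complex.norm_exp_ofReal_mul_I]
    simp

theorem tMat_pow_six : tMat ^ 6 = Matrix.diagonal fun a => if a = true then -Complex.I else 1 := by
  rw [tMat, Matrix.diagonal_pow]
  congr 1
  funext a
  cases a
  · simp
  · simp only [Pi.pow_apply, if_true]
    rw [show 6 = 2 * 3 by norm_num, pow_mul, exp_pi_div_four_pow_two, pow_succ, Complex.I_sq]
    simp

/-- The inverse phase gate diag(1, -i), which turns X into Y by conjugation, is T⁶. -/
theorem tMat_pow_six_conj_X : (tMat ^ 6)ᴴ * pauliMat 1 * tMat ^ 6 = pauliMat 2 := by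
  rw [tMat_pow_six, Matrix.diagonal_conjTranspose]
  ext a b
  rw [Matrix.mul_diagonal, Matrix.diagonal_mul]
  cases a <;> cases b <;> simp [pauliMat, pauli₁]

theorem tensorOp_conj_local (f : W → Matrix Bool Bool ℂ) (i : W) (A : Matrix Bool Bool ℂ) :
    (tensorOp (Function.update (fun _ => 1) i A))ᴴ * tensorOp f *
        tensorOp (Function.update (fun _ => 1) i A) =
      tensorOp (Function.update f i (Aᴴ * f i * A)) := by
  rw [tensorOp_conjTranspose, tensorOp_mul, tensorOp_mul]
  congr 1
  funext w
  by_cases h : w = i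
  · subst h; simp
  · simp [h]

theorem cnot_conj_apply (c t : W) (h : c ≠ t) (A : Op W) (a b : W → Bool) :
    ((Gate.CNOT c t h).toOpᴴ * A * (Gate.CNOT c t h).toOp) a b =
      A (Function.update a t (xor (a t) (a c))) (Function.update b t (xor (b t) (b c))) := by
  simp [Matrix.mul_apply, Gate.toOp, Matrix.conjTranspose_apply]

/-- In the Heisenberg picture CNOT spreads Z from the target to the control: 1 ⊗ Z becomes Z ⊗ Z.
With b' the target bit after the gate, the sign (-1)^b' is the product of the signs of both bits
before it. -/
theorem cnot_conj_tensorOp (c t : W) (h : c ≠ t) (f : W → Matrix Bool Bool ℂ)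
    (hc : f c = 1) (ht : f t = pauliMat 3) :
    (Gate.CNOT c t h).toOpᴴ * tensorOp f * (Gate.CNOT c t h).toOp =
      tensorOp (Function.update f c (pauliMat 3)) := by
  ext a b
  have hct : c ∈ Finset.univ.erase t := Finset.mem_erase.2 ⟨h, Finset.mem_univ c⟩
  rw [cnot_conj_apply, tensorOp_apply, tensorOp_apply,
    ← Finset.mul_prod_erase _ _ (Finset.mem_univ t), ← Finset.mul_prod_erase _ _ hct,
    ← Finset.mul_prod_erase _ _ (Finset.mem_univ t), ← Finset.mul_prod_erase _ _ hct,
    ← mul_assoc, ← mul_assoc]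
  congr 1
  · rw [Function.update_self, Function.update_self, Function.update_of_ne h,
      Function.update_of_ne h, Function.update_self, Function.update_of_ne h.symm, hc, ht]
    cases a c <;> cases a t <;> cases b c <;> cases b t <;> simp [pauliMat, pauli₁]
  · refine Finset.prod_congr rfl fun w hw => ?_
    have hw1 : w ≠ c := Finset.ne_of_mem_erase hw
    have hw2 : w ≠ t := Finset.ne_of_mem_erase (Finset.mem_of_mem_erase hw)
    rw [Function.update_of_ne hw2, Function.update_of_ne hw2, Function.update_of_ne hw1]

theorem toOp_conjTranspose_mul_self (g : Gate W) : g.toOpᴴ * g.toOp = 1 := by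
  have hloc : ∀ (i : W) (A : Matrix Bool Bool ℂ), Aᴴ * A = 1 →
      (tensorOp (Function.update (fun _ : W => (1 : Matrix Bool Bool ℂ)) i A))ᴴ *
        tensorOp (Function.update (fun _ => 1) i A) = 1 := by
    intro i A hA
    have h := tensorOp_conj_local (fun _ => 1) i A
    rwa [tensorOp_one, mul_one, mul_one, hA, Function.update_eq_self_iff.2 rfl, tensorOp_one] at h
  cases g with
  | H i =>
    rw [toOp_H]
    exact hloc i _ (by rw [hadamardMat_conjTranspose, hadamardMat_mul_self])
  | T i =>
    rw [toOp_T]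
    exact hloc i _ tMat_conj_mul_self
  | CNOT c t h =>
    ext a b
    have e := cnot_conj_apply c t h 1 a b
    rw [mul_one] at e
    rw [e, Matrix.one_apply, Matrix.one_apply]
    refine if_congr ⟨fun hab => ?_, fun hab => by rw [hab]⟩ rfl rfl
    have hw : ∀ w, w ≠ t → a w = b w := fun w hw => by
      have := congrFun hab w
      rwa [Function.update_of_ne hw, Function.update_of_ne hw] at this
    funext w
    by_cases hwt : w = t
    · have := congrFun hab t
      rw [Function.update_self, Function.update_self, hw c h] at this
      rw [hwt]
      exact Bool.xor_right_inj.1 (by rw [Bool.xor_comm, this, Bool.xor_comm])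
    · exact hw w hwt

/-- The observable `O`, measured after the gates, as an observable before the gates. -/
def pullback : List (Gate W) → Op W → Op W
  | [], O => O
  | g :: gs, O => g.toOpᴴ * pullback gs O * g.toOp

theorem pullback_append (gs hs : List (Gate W)) (O : Op W) :
    pullback (gs ++ hs) O = pullback gs (pullback hs O) := by
  induction gs with
  | nil => rfl
  | cons g gs ih => simp only [List.cons_append, pullback, ih]

theorem pullback_one (gs : List (Gate W)) : pullback gs 1 = 1 := by
  induction gs with
  | nil => rfl
  | cons g gs ih => rw [pullback, ih, mul_one, toOp_conjTranspose_mul_self]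

/-- `unitary` multiplies later gates on the left, so conjugating an observable meets the last gate
first, which is the order of `pullback`. -/
theorem foldl_conj (gs : List (Gate W)) (O U : Op W) :
    (gs.foldl (fun U g => g.toOp * U) U)ᴴ * O * gs.foldl (fun U g => g.toOp * U) U =
      Uᴴ * pullback gs O * U := by
  induction gs generalizing U with
  | nil => rfl
  | cons g gs ih =>
    rw [List.foldl_cons, ih, pullback, Matrix.conjTranspose_mul]
    simp only [Matrix.mul_assoc]

theorem trace_mul_unitary_conj {In Out : Type} [Fintype In] [DecidableEq In] [Fintype Out]
    [DecidableEq Out] (C : Circuit In Out) (O σ : Op (In ⊕ Fin C.anc)) :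
    (O * (C.unitary * σ * C.unitaryᴴ)).trace = (pullback C.gates O * σ).trace := by
  have h := foldl_conj C.gates O 1
  rw [Matrix.conjTranspose_one, one_mul, mul_one] at h
  rw [← h, ← Matrix.mul_assoc, ← Matrix.mul_assoc, Matrix.trace_mul_comm, ← Matrix.mul_assoc,
    ← Matrix.mul_assoc]
  rfl

theorem pullback_H_tensorOp (i : W) (f : W → Matrix Bool Bool ℂ) (O : Op W) (gs : List (Gate W))
    (h : pullback gs O = tensorOp f) (hi : f i = pauliMat 3) :
    pullback (.H i :: gs) O = tensorOp (Function.update f i (pauliMat 1)) := by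
  rw [pullback, h, toOp_H,
    tensorOp_conj_local, hi,
    hadamardMat_conj_Z]

theorem pullback_T_tensorOp (i : W) (f : W → Matrix Bool Bool ℂ) (O : Op W) (gs : List (Gate W))
    (m : ℕ) (h : pullback gs O = tensorOp f) :
    pullback (List.replicate m (.T i) ++ gs) O =
      tensorOp (Function.update f i ((tMat ^ m)ᴴ * f i * tMat ^ m)) := by
  induction m with
  | zero => simp [h]
  | succ m ih =>
    rw [List.replicate_succ, List.cons_append, pullback, ih, toOp_T,
      tensorOp_conj_local, Function.update_idem, Function.update_self,
      pow_succ, Matrix.conjTranspose_mul]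
    simp only [Matrix.mul_assoc]

end Heisenberg

/-! ### Measuring the parity of a Pauli string -/

section Parity

variable {In : Type}

/-- Gates adding the outcome of a one-qubit Pauli measurement to the ancilla. -/
def parityGates (c : Fin 4) (i : In) : List (Gate (In ⊕ Fin 1)) :=
  match c with
  | 0 => []
  | 1 => [.H (.inl i), .CNOT (.inl i) (.inr 0) Sum.inl_ne_inr]
  | 2 => List.replicate 6 (.T (.inl i)) ++
      [.H (.inl i), .CNOT (.inl i) (.inr 0) Sum.inl_ne_inr]
  | 3 => [.CNOT (.inl i) (.inr 0) Sum.inl_ne_inr]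

theorem length_parityGates_le (c : Fin 4) (i : In) : (parityGates c i).length ≤ 8 := by
  fin_cases c <;> simp [parityGates]

/-- The circuit computing the parity of the outcomes of measuring the Pauli matrices `p i`. -/
def parityCircuit [Fintype In] (p : In → Fin 4) : Circuit In (Fin 1) where
  anc := 1
  gates := (Finset.univ : Finset In).toList.flatMap fun i => parityGates (p i) i
  out := ⟨fun _ => .inr 0, Function.injective_of_subsingleton _⟩

theorem size_parityCircuit_le [Fintype In] (p : In → Fin 4) :
    (parityCircuit p).size ≤ 10 * Fintype.card In + 2 := by
  have h : (parityCircuit p).gates.length ≤ 8 * Fintype.card In := by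
    rw [parityCircuit, List.length_flatMap]
    refine (List.sum_le_card_nsmul _ 8 ?_).trans ?_
    · simp only [List.mem_map]
      rintro _ ⟨i, _, rfl⟩
      exact length_parityGates_le _ _
    · simp [mul_comm]
  have h1 : Fintype.card (In ⊕ Fin (parityCircuit p).anc) = Fintype.card In + 1 :=
    Fintype.card_sum.trans (congrArg _ (Fintype.card_fin 1))
  rw [Circuit.size, h1]
  omega

variable [Fintype In] [DecidableEq In]

/-- Pulled back through CNOT, the Z on the ancilla acquires a factor Z on the wire; H turns this
factor into X, and six T gates turn X into Y. -/
theorem pullback_parityGates (c : Fin 4) (i : In) (f : In ⊕ Fin 1 → Matrix Bool Bool ℂ)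
    (hi : f (.inl i) = 1) (ha : f (.inr 0) = pauliMat 3) :
    pullback (parityGates c i) (tensorOp f) =
      tensorOp (Function.update f (.inl i) (pauliMat c)) := by
  have h3 : pullback [.CNOT (.inl i) (.inr 0) Sum.inl_ne_inr] (tensorOp f) =
      tensorOp (Function.update f (.inl i) (pauliMat 3)) := by
    rw [pullback, pullback, cnot_conj_tensorOp _ _ _ _ hi ha]
  have h1 := pullback_H_tensorOp _ _ _ _ h3 (Function.update_self _ _ _)
  rw [Function.update_idem] at h1
  have h2 := pullback_T_tensorOp (.inl i) _ _ _ 6 h1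
  rw [Function.update_idem, Function.update_self, tMat_pow_six_conj_X] at h2
  fin_cases c
  · rw [show pauliMat ((fun c => c) ⟨0, _⟩) = 1 from pauliMat_zero, ← hi, Function.update_eq_self]
    rfl
  · exact h1
  · exact h2
  · exact h3

/-- Each wire is visited once, so it still carries the identity when its gates are pulled back,
while the ancilla keeps its Z throughout. -/
theorem pullback_flatMap_parityGates (p : In → Fin 4) (ws : List In) (hws : ws.Nodup) :
    pullback (ws.flatMap fun i => parityGates (p i) i)
        (tensorOp (Sum.elim (fun _ => 1) fun _ : Fin 1 => pauliMat 3)) =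
      tensorOp (Sum.elim (fun i => if i ∈ ws then pauliMat (p i) else 1) fun _ => pauliMat 3) := by
  induction ws with
  | nil => simp [pullback]
  | cons i ws ih =>
    rw [List.nodup_cons] at hws
    rw [List.flatMap_cons, pullback_append, ih hws.2, pullback_parityGates]
    · congr 1
      funext w
      rcases w with j | j
      · by_cases hj : j = i
        · subst hj; simp
        · simp [hj]
      · simp
    · simp [hws.1]
    · simp

/-- Acceptance is measured by the projector (1 - Z)/2 on the output wire. In the partial trace the
two basis vectors agree on the traced-out wires by definition and on the output wire because both
entries are `true`, so only diagonal entries remain. -/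
theorem acceptProb_eq_trace {C : Circuit In (Fin 1)} (ρ : Op In) (w : In ⊕ Fin C.anc)
    (hw : ∀ o, C.out o = w) :
    C.acceptProb ρ = (((2 : ℂ)⁻¹ • (1 - tensorOp (Function.update (fun _ => 1) w (pauliMat 3)))) *
      (C.unitary * C.withAncillas ρ * C.unitaryᴴ)).trace.re := by
  rw [Circuit.acceptProb, Circuit.run]
  congr 1
  set σ := C.unitary * C.withAncillas ρ * C.unitaryᴴ
  have hd : tensorOp (Function.update (fun _ => 1) w (pauliMat 3)) =
      Matrix.diagonal fun a : In ⊕ Fin C.anc → Bool => if a w = true then (-1 : ℂ) else 1 := by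
    ext a b
    rw [tensorOp_update_one_apply, Matrix.diagonal_apply]
    by_cases h : a = b
    · subst h; simp [pauliMat, pauli₁]
    · rw [if_neg h, ite_eq_right_iff]
      intro h1
      have : a w ≠ b w := fun h2 => h (funext fun j => by
        by_cases hj : j = w
        · rw [hj, h2]
        · exact h1 j hj)
      simp [pauliMat, pauli₁, this]
  have hp : (2 : ℂ)⁻¹ • (1 - tensorOp (Function.update (fun _ => 1) w (pauliMat 3))) =
      Matrix.diagonal fun a : In ⊕ Fin C.anc → Bool => if a w = true then (1 : ℂ) else 0 := by
    rw [hd, ← Matrix.diagonal_one, Matrix.diagonal_sub, ← Matrix.diagonal_smul]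
    congr 1
    funext a
    simp only [Pi.smul_apply, smul_eq_mul]
    split_ifs <;> norm_num
  rw [hp, Circuit.keepOut, Matrix.of_apply, Matrix.trace]
  refine Finset.sum_congr rfl fun c _ => ?_
  rw [Matrix.diag, Matrix.diagonal_mul, Finset.sum_eq_single c]
  · simp [hw]
  · intro c' _ hc
    rw [if_neg]
    rintro ⟨h1, h2, h3⟩
    simp only [hw] at h1 h2 h3
    refine hc (funext fun v => ?_)
    by_cases hv : v = w
    · rw [hv, h1 0, h2 0]
    · exact (h3 v fun _ => Ne.symm hv).symm
  · simp

theorem sum_sumArrow {A B : Type} [Fintype A] [Fintype B] [DecidableEq A] [DecidableEq B]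
    (F : (A ⊕ B → Bool) → ℂ) :
    ∑ a, F a = ∑ x : A → Bool, ∑ y : B → Bool, F (Sum.elim x y) := by
  rw [← (Equiv.sumArrowEquivProdArrow A B Bool).symm.sum_comp, Fintype.sum_prod_type]
  rfl

/-- Ancillas in state |0⟩ contribute ⟨0|B|0⟩ = 1 each. Both B = 1 and B = Z qualify. -/
theorem trace_tensorOp_mul_withAncillas {Out : Type} [Fintype Out] [DecidableEq Out]
    (C : Circuit In Out) (ρ : Op In) (f : In → Matrix Bool Bool ℂ) (B : Matrix Bool Bool ℂ)
    (hB : B false false = 1) :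
    (tensorOp (Sum.elim f fun _ => B) * C.withAncillas ρ).trace = (tensorOp f * ρ).trace := by
  simp only [Matrix.trace, Matrix.diag, Matrix.mul_apply, sum_sumArrow]
  refine Finset.sum_congr rfl fun x _ => ?_
  rw [Finset.sum_eq_single fun _ => false]
  · refine Finset.sum_congr rfl fun x' _ => ?_
    rw [Finset.sum_eq_single fun _ => false]
    · simp [Circuit.withAncillas, tensorOp_apply, Fintype.prod_sum_type, hB]
    · intro y _ hy
      obtain ⟨j, hj⟩ := Function.ne_iff.1 hy
      rw [Circuit.withAncillas, Matrix.of_apply, if_neg, mul_zero]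
      exact fun h => hj (h.1 j)
    · simp
  · intro y _ hy
    obtain ⟨j, hj⟩ := Function.ne_iff.1 hy
    refine Finset.sum_eq_zero fun x' _ => Finset.sum_eq_zero fun y' _ => ?_
    rw [Circuit.withAncillas, Matrix.of_apply, if_neg, mul_zero]
    exact fun h => hj (h.2 j)
  · simp

/-- The acceptance probability of the parity circuit. -/
theorem acceptProb_parityCircuit (p : In → Fin 4) (ρ : Op In) :
    (parityCircuit p).acceptProb ρ =
      ((ρ.trace - (tensorOp (fun i => pauliMat (p i)) * ρ).trace) / 2).re := by
  rw [acceptProb_eq_trace ρ (.inr 0 : In ⊕ Fin 1) fun _ => rfl, Matrix.smul_mul, Matrix.trace_smul, sub_mul,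
    Matrix.trace_sub, one_mul]
  have h1 := trace_mul_unitary_conj (parityCircuit p) 1 ((parityCircuit p).withAncillas ρ)
  have hZ : tensorOp (Function.update (fun _ => 1) (.inr 0 : In ⊕ Fin 1) (pauliMat 3)) =
      tensorOp (Sum.elim (fun _ : In => (1 : Matrix Bool Bool ℂ)) fun _ : Fin 1 => pauliMat 3) := by
    congr 1
    funext w
    rcases w with j | j
    · simp
    · rw [Subsingleton.elim j 0]; simp
  have h2 := trace_mul_unitary_conj (parityCircuit p)
    (tensorOp (Function.update (fun _ => 1) (.inr 0 : In ⊕ Fin 1) (pauliMat 3)))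
    ((parityCircuit p).withAncillas ρ)
  have h3 : pullback (parityCircuit p).gates
      (tensorOp (Function.update (fun _ => 1) (.inr 0 : In ⊕ Fin 1) (pauliMat 3))) =
        tensorOp (Sum.elim (fun i => pauliMat (p i)) fun _ => pauliMat 3) := by
    refine (congrArg _ hZ).trans ((pullback_flatMap_parityGates p _ (Finset.nodup_toList _)).trans ?_)
    simp only [Finset.mem_toList, Finset.mem_univ, if_true]
    rfl
  rw [h3] at h2
  rw [pullback_one, one_mul, one_mul] at h1
  have h4 := trace_tensorOp_mul_withAncillas (parityCircuit p) ρ (fun _ => 1) 1 (by simp)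
  rw [tensorOp_one, one_mul, show (Sum.elim (fun _ => 1) fun _ => 1 :
    In ⊕ Fin (parityCircuit p).anc → Matrix Bool Bool ℂ) = fun _ => 1 by
      funext w; rcases w <;> rfl, tensorOp_one, one_mul] at h4
  rw [h1, h2, h4, trace_tensorOp_mul_withAncillas _ _ _ _ (by simp [pauliMat, pauli₁]),
    smul_eq_mul, inv_mul_eq_div]

end Parity

/-! ### Pauli correlators of challenge states -/

theorem sum_sum_prod {ι A : Type} [Fintype ι] [DecidableEq ι] [Fintype A]
    (F : ι → A → A → ℂ) :
    ∑ y : ι → A, ∑ y' : ι → A, ∏ i, F i (y i) (y' i) = ∏ i, ∑ u, ∑ u', F i u u' := by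
  rw [Finset.prod_univ_sum, Fintype.piFinset_univ]
  refine Finset.sum_congr rfl fun y _ => ?_
  rw [Finset.prod_univ_sum, Fintype.piFinset_univ]

theorem sum_sum_curry {A B : Type} [Fintype A] [Fintype B] [DecidableEq A] [DecidableEq B]
    (F : (A → B → Bool) → (A → B → Bool) → ℂ) :
    ∑ y : A × B → Bool, ∑ y' : A × B → Bool,
        F (fun i j => y (i, j)) (fun i j => y' (i, j)) =
      ∑ y : A → B → Bool, ∑ y' : A → B → Bool, F y y' := by
  rw [← (Equiv.curry A B Bool).sum_comp]
  refine Finset.sum_congr rfl fun y _ => ?_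
  rw [← (Equiv.curry A B Bool).sum_comp]
  rfl

theorem sum_sum_mul_sum_sum {A B : Type} [Fintype A] [Fintype B] (X : A → A → ℂ) (Y : B → B → ℂ) :
    (∑ a, ∑ b, X a b) * (∑ a', ∑ b', Y a' b') = ∑ a, ∑ a', ∑ b, ∑ b', X a b * Y a' b' := by
  rw [Finset.sum_mul_sum]
  exact Finset.sum_congr rfl fun a _ => Finset.sum_congr rfl fun a' _ => Finset.sum_mul_sum ..

/-- The Pauli string acting with `Q i j` on the `j`-th copy of the `i`-th state. -/
def copiesString {s t d n q : ℕ} (Q : Fin s → Fin t → Fin n → Fin 4) :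
    ChallengeWires s t d n q → Fin 4 :=
  Sum.elim (Sum.elim (fun _ => 0) fun w => Q w.1 w.2.1 w.2.2) fun _ => 0

/-- The trace of a product of tensor products factors: the register of inputs contributes 1, and
each copy of each state contributes its own Pauli expectation. -/
theorem trace_copiesString_mul_challenge {s t d n : ℕ} (Q : Fin s → Fin t → Fin n → Fin 4)
    (x : Fin s → Fin d → Bool) (σ : Fin s → Op (Fin n)) :
    (tensorOp (fun w => pauliMat (copiesString Q w)) *
        challenge t x σ (1 : Op (Fin 0))).trace =
      ∏ i, ∏ j, (pauli (Q i j) * σ i).trace := by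
  have hP : ∀ a b : Fin s × Fin t × Fin n → Bool,
      (∏ w : Fin s × Fin t × Fin n, pauliMat (Q w.1 w.2.1 w.2.2) (a w) (b w)) *
        (∏ i, ∏ j, σ i (fun m => b (i, j, m)) (fun m => a (i, j, m))) =
      ∏ i, ∏ j, (pauli (Q i j) (fun m => a (i, j, m)) (fun m => b (i, j, m)) *
        σ i (fun m => b (i, j, m)) (fun m => a (i, j, m))) := by
    intro a b
    simp only [Fintype.prod_prod_type, Finset.prod_mul_distrib]
    rfl
  have hx : ∀ a b : Fin s × Fin d → Bool,
      (∏ w, (1 : Matrix Bool Bool ℂ) (a w) (b w)) *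
        basisState (fun ij : Fin s × Fin d => x ij.1 ij.2) b a =
      if a = (fun ij => x ij.1 ij.2) then if b = (fun ij => x ij.1 ij.2) then 1 else 0 else 0 := by
    intro a b
    have : ∏ w, (1 : Matrix Bool Bool ℂ) (a w) (b w) = if a = b then 1 else 0 := by
      rw [← Matrix.one_apply, ← tensorOp_one, tensorOp_apply]
    rw [this, basisState, Matrix.of_apply]
    by_cases h1 : a = fun ij => x ij.1 ij.2
    · by_cases h2 : b = fun ij => x ij.1 ij.2
      · simp [h1, h2]
      · simp [h1, h2]
    · simp [h1]
  calc _ = (∑ a : Fin s × Fin d → Bool, ∑ b : Fin s × Fin d → Bool,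
          (∏ w, (1 : Matrix Bool Bool ℂ) (a w) (b w)) *
            basisState (fun ij : Fin s × Fin d => x ij.1 ij.2) b a) *
        ∑ a : Fin s × Fin t × Fin n → Bool, ∑ b : Fin s × Fin t × Fin n → Bool,
          ∏ i, ∏ j, (pauli (Q i j) (fun m => a (i, j, m)) (fun m => b (i, j, m)) *
            σ i (fun m => b (i, j, m)) (fun m => a (i, j, m))) := by
        rw [sum_sum_mul_sum_sum]
        simp only [Matrix.trace, Matrix.diag, Matrix.mul_apply, sum_sumArrow]
        refine Finset.sum_congr rfl fun a _ => Finset.sum_congr rfl fun a' _ => ?_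
        rw [Fintype.sum_unique]
        refine Finset.sum_congr rfl fun b _ => Finset.sum_congr rfl fun b' _ => ?_
        rw [Fintype.sum_unique, ← hP]
        simp only [tensorOp_apply, challenge, Matrix.of_apply, Fintype.prod_sum_type, copiesString,
          Sum.elim_inl, Sum.elim_inr, pauliMat_zero, Finset.univ_eq_empty, Finset.prod_empty,
          mul_one]
        rw [Matrix.one_apply, if_pos (Subsingleton.elim _ _)]
        ring
    _ = ∏ i, ∏ j, (pauli (Q i j) * σ i).trace := by
        simp only [hx]
        simp only [Finset.sum_ite_irrel, Finset.sum_const_zero, Finset.sum_ite_eq',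
          Finset.mem_univ, if_true, one_mul]
        rw [sum_sum_curry fun a b => ∏ i, ∏ j : Fin t,
          (pauli (Q i j) (fun m => a i (j, m)) (fun m => b i (j, m)) *
            σ i (fun m => b i (j, m)) (fun m => a i (j, m))),
          sum_sum_prod (A := Fin t × Fin n → Bool) fun i a b => ∏ j : Fin t,
            (pauli (Q i j) (fun m => a (j, m)) (fun m => b (j, m)) *
              σ i (fun m => b (j, m)) (fun m => a (j, m)))]
        refine Finset.prod_congr rfl fun i _ => ?_
        rw [sum_sum_curry fun a b => ∏ j : Fin t,
            (pauli (Q i j) (a j) (b j) * σ i (b j) (a j)),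
          sum_sum_prod (A := Fin n → Bool) fun j a b => pauli (Q i j) a b * σ i b a]
        simp only [Matrix.trace, Matrix.diag, Matrix.mul_apply]

/-- The product of the expectations of Pauli observables on copies of states. -/
def correlator {s t n : ℕ} (Q : Fin s → Fin t → Fin n → Fin 4) (σ : Fin s → Op (Fin n)) : ℝ :=
  ∏ i, ∏ j, (pauli (Q i j) * σ i).trace.re

theorem acceptProb_copiesString {s t d n : ℕ} (Q : Fin s → Fin t → Fin n → Fin 4)
    (x : Fin s → Fin d → Bool) {σ : Fin s → Op (Fin n)} (hσ : ∀ i, IsDensity (σ i)) :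
    (parityCircuit (copiesString Q)).acceptProb (challenge t x σ (1 : Op (Fin 0))) =
      (1 - correlator Q σ) / 2 := by
  -- The all-identity Pauli string gives the trace of the challenge state, which is 1.
  have h := trace_copiesString_mul_challenge (fun (_ : Fin s) (_ : Fin t) (_ : Fin n) => 0) x σ
  have h0 : (fun w => pauliMat (copiesString (fun (_ : Fin s) (_ : Fin t) (_ : Fin n) => 0) w)) =
      fun _ : ChallengeWires s t d n 0 => 1 := by
    funext w
    rcases w with (w | w) | w <;> exact pauliMat_zero
  simp only [h0, tensorOp_one, one_mul, pauli_zero, fun i => (hσ i).2, Finset.prod_const_one] at h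
  rw [acceptProb_parityCircuit, trace_copiesString_mul_challenge, h]
  simp only [← fun i j => coe_pauliMean (hσ i).1.isHermitian (Q i j)]
  rw [correlator]
  have : ((1 - ∏ i, ∏ j, (pauliMean (σ i) (Q i j) : ℂ)) / 2) =
    (((1 - ∏ i, ∏ j, pauliMean (σ i) (Q i j)) / 2 : ℝ) : ℂ) := by push_cast; rfl
  rw [this, Complex.ofReal_re]
  rfl

/-! ### Overlaps of Haar-random states -/

section Haar

variable {W : Type} [Fintype W] [DecidableEq W]

theorem norm_sq_add_smul_inner (φ x : Ket W) (hφ : ‖φ‖ = 1) (s : ℝ) :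
    ‖x + ((s - 1 : ℝ) * inner ℂ φ x : ℂ) • φ‖ ^ 2 =
      ‖x‖ ^ 2 + (s ^ 2 - 1) * ‖inner ℂ φ x‖ ^ 2 := by
  rw [norm_add_sq (𝕜 := ℂ), inner_smul_right, norm_smul, hφ, norm_mul, mul_one, mul_pow,
    mul_assoc, ← inner_conj_symm x φ, Complex.mul_conj, Complex.normSq_eq_norm_sq,
    Complex.norm_real, Real.norm_eq_abs, sq_abs]
  simp only [← Complex.ofReal_mul, RCLike.re_to_complex, Complex.ofReal_re]
  ring

/-- Shrink the component along φ by s = (2 + c)^(-1/2). This maps the cone of vectors nearly aligned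
with φ into a ball of radius r = (2/(2 + c))^(1/2). Comparing volumes gives s² μ(cone) ≤ r^(2N)
μ(ball), where N is the complex dimension. -/
theorem addHaar_cone_le (φ : Ket W) (hφ : ‖φ‖ = 1) {c : ℝ} (hc : 0 ≤ c) :
    (Measure.addHaar : Measure (Ket W)) {x | ‖x‖ < 1 ∧ c * ‖x‖ ^ 2 ≤ ‖inner ℂ φ x‖ ^ 2} ≤
      ENNReal.ofReal ((2 + c) * (2 / (2 + c)) ^ Fintype.card (W → Bool)) *
        (Measure.addHaar : Measure (Ket W)) (Metric.ball 0 1) := by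
  set μ := (Measure.addHaar : Measure (Ket W))
  set K : Set (Ket W) := {x | ‖x‖ < 1 ∧ c * ‖x‖ ^ 2 ≤ ‖inner ℂ φ x‖ ^ 2}
  set s : ℝ := √(1 / (2 + c)) with hs
  set r : ℝ := √(2 / (2 + c)) with hr
  have hs2 : s ^ 2 = 1 / (2 + c) := Real.sq_sqrt (by positivity)
  have hr2 : r ^ 2 = 2 / (2 + c) := Real.sq_sqrt (by positivity)
  have hr0 : 0 < r := by positivity
  set f : Ket W →ₗ[ℂ] ℂ := ((s - 1 : ℝ) : ℂ) • (innerSL ℂ φ : Ket W →L[ℂ] ℂ).toLinearMap with hf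
  set T := LinearMap.transvection f φ
  have hT : ∀ x, T x = x + ((s - 1 : ℝ) * inner ℂ φ x : ℂ) • φ := fun x => rfl
  -- The complex determinant of the transvection is s; the real one is its squared modulus.
  have hdet : (T.restrictScalars ℝ).det = s ^ 2 := by
    rw [LinearMap.det_restrictScalars, LinearMap.transvection.det]
    have : f φ = ((s - 1 : ℝ) : ℂ) := by
      simp [hf, inner_self_eq_norm_sq_to_K, hφ]
    rw [this, Algebra.norm_complex_apply, show (1 + ((s - 1 : ℝ) : ℂ)) = (s : ℂ) by push_cast; ring,
      Complex.normSq_ofReal, sq]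
  have himg : T.restrictScalars ℝ '' K ⊆ Metric.ball 0 r := by
    rintro _ ⟨x, ⟨hx1, hx2⟩, rfl⟩
    rw [mem_ball_zero_iff, LinearMap.restrictScalars_apply, hT]
    refine lt_of_pow_lt_pow_left₀ 2 hr0.le ?_
    rw [norm_sq_add_smul_inner φ x hφ, hs2, hr2]
    have hx3 : ‖x‖ ^ 2 < 1 := by
      rw [sq_lt_one_iff₀ (norm_nonneg _)]; exact hx1
    have h1 : 1 / (2 + c) - 1 = - ((1 + c) / (2 + c)) := by field_simp; ring
    rw [h1]
    have h2 : (1 + c) / (2 + c) * (c * ‖x‖ ^ 2) ≤ (1 + c) / (2 + c) * ‖inner ℂ φ x‖ ^ 2 := by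
      gcongr
    have h3 : ‖x‖ ^ 2 - (1 + c) / (2 + c) * (c * ‖x‖ ^ 2) ≤ 2 / (2 + c) * ‖x‖ ^ 2 := by
      have : 2 / (2 + c) * ‖x‖ ^ 2 - (‖x‖ ^ 2 - (1 + c) / (2 + c) * (c * ‖x‖ ^ 2)) =
        c ^ 2 / (2 + c) * ‖x‖ ^ 2 := by field_simp; ring
      have : 0 ≤ c ^ 2 / (2 + c) * ‖x‖ ^ 2 := by positivity
      linarith
    have h4 : 2 / (2 + c) * ‖x‖ ^ 2 < 2 / (2 + c) :=
      mul_lt_of_lt_one_right (by positivity) hx3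
    linarith
  have h := measure_mono (μ := μ) himg
  rw [Measure.addHaar_image_linearMap, hdet, Measure.addHaar_ball μ 0 hr0.le] at h
  have hrank : Module.finrank ℝ (Ket W) = 2 * Fintype.card (W → Bool) := by
    rw [finrank_real_of_complex, finrank_euclideanSpace]
  rw [hrank, pow_mul, hr2, hs2, abs_of_pos (by positivity)] at h
  calc μ K = ENNReal.ofReal (2 + c) * (ENNReal.ofReal (1 / (2 + c)) * μ K) := by
        rw [← mul_assoc, ← ENNReal.ofReal_mul (by positivity), mul_one_div_cancel (by positivity)]
        simp
    _ ≤ ENNReal.ofReal (2 + c) *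
        (ENNReal.ofReal ((2 / (2 + c)) ^ Fintype.card (W → Bool)) * μ (Metric.ball 0 1)) := by
        gcongr
    _ = _ := by rw [← mul_assoc, ← ENNReal.ofReal_mul (by positivity)]

instance : IsProbabilityMeasure (haar W) := by
  refine ⟨?_⟩
  rw [haar, Measure.smul_apply, smul_eq_mul]
  refine ENNReal.inv_mul_cancel ?_ (measure_ne_top _ _)
  rw [Ne, Measure.measure_univ_eq_zero]
  exact Measure.toSphere_ne_zero _

-- The measure of a subset of the sphere is proportional to the volume of the cone over it in the
-- unit ball, so the cone bound carries over; the normalizing constants cancel.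
open scoped Pointwise in
theorem haar_cap_le (φ : Ket W) (hφ : ‖φ‖ = 1) {c : ℝ} (hc : 0 ≤ c) :
    haar W {θ | c ≤ ‖inner ℂ φ θ.1‖ ^ 2} ≤
      ENNReal.ofReal ((2 + c) * (2 / (2 + c)) ^ Fintype.card (W → Bool)) := by
  set μ := (Measure.addHaar : Measure (Ket W))
  have hmeas : MeasurableSet {θ : Metric.sphere (0 : Ket W) 1 | c ≤ ‖inner ℂ φ θ.1‖ ^ 2} :=
    (isClosed_le continuous_const (by fun_prop)).measurableSet
  have hball : μ (Metric.ball 0 1) ≠ 0 := (Metric.measure_ball_pos μ 0 one_pos).ne'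
  have hball' : μ (Metric.ball 0 1) ≠ ⊤ := measure_ball_lt_top.ne
  have hrank : (Module.finrank ℝ (Ket W) : ENNReal) ≠ 0 := by
    exact_mod_cast (Module.finrank_pos (R := ℝ) (M := Ket W)).ne'
  rw [haar, Measure.smul_apply, smul_eq_mul, Measure.toSphere_apply' _ hmeas,
    Measure.toSphere_apply_univ]
  have hsub : Set.Ioo (0 : ℝ) 1 • ((↑) '' {θ : Metric.sphere (0 : Ket W) 1 |
      c ≤ ‖inner ℂ φ θ.1‖ ^ 2} : Set (Ket W)) ⊆
        {x | ‖x‖ < 1 ∧ c * ‖x‖ ^ 2 ≤ ‖inner ℂ φ x‖ ^ 2} := by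
    rintro _ ⟨a, ⟨ha0, ha1⟩, _, ⟨θ, hθ, rfl⟩, rfl⟩
    have hn : ‖(a • (θ : Ket W))‖ = a := by
      rw [norm_smul, Real.norm_of_nonneg ha0.le, norm_eq_of_mem_sphere, mul_one]
    have hi : ‖inner ℂ φ (a • (θ : Ket W))‖ = a * ‖inner ℂ φ (θ : Ket W)‖ := by
      rw [← Complex.coe_smul, inner_smul_right, norm_mul, Complex.norm_real,
        Real.norm_of_nonneg ha0.le]
    simp only [Set.mem_ofPred_eq] at hθ ⊢
    rw [hn, hi, mul_pow, mul_comm c]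
    exact ⟨ha1, by gcongr⟩
  have h := (measure_mono (μ := μ) hsub).trans (addHaar_cone_le φ hφ hc)
  refine (mul_le_mul_right (mul_le_mul_right h _) _).trans_eq ?_
  rw [mul_left_comm (Module.finrank ℝ (Ket W) : ENNReal), mul_left_comm,
    ENNReal.inv_mul_cancel (mul_ne_zero hrank hball)
      (ENNReal.mul_ne_top (ENNReal.natCast_ne_top _) hball'), mul_one]

theorem trace_ketbra_mul (θ φ : Ket W) :
    (ketbra θ * ketbra φ).trace = ((‖inner ℂ θ φ‖ ^ 2 : ℝ) : ℂ) := by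
  rw [← Complex.normSq_eq_norm_sq, ← Complex.mul_conj, inner_conj_symm]
  simp only [PiLp.inner_apply, Matrix.trace, Matrix.diag, Matrix.mul_apply, ketbra,
    Matrix.of_apply, Finset.sum_mul_sum]
  rw [Finset.sum_comm]
  refine Finset.sum_congr rfl fun a _ => Finset.sum_congr rfl fun b _ => ?_
  simp
  ring

theorem ketbra_posSemidef (θ : Ket W) : (ketbra θ).PosSemidef := by
  have : ketbra θ = Matrix.vecMulVec (fun a => θ a) (star fun a => θ a) := by
    ext a b
    simp [ketbra, Matrix.vecMulVec_apply]
  rw [this]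
  exact Matrix.posSemidef_vecMulVec_self_star _

theorem trace_ketbra (θ : Ket W) (hθ : ‖θ‖ = 1) : (ketbra θ).trace = 1 := by
  have h : (inner ℂ θ θ : ℂ) = 1 := by rw [inner_self_eq_norm_sq_to_K, hθ]; simp
  rw [← h, PiLp.inner_apply, Matrix.trace]
  exact Finset.sum_congr rfl fun a _ => by simp [ketbra, Complex.mul_conj']

theorem isDensity_ketbra (θ : Ket W) (hθ : ‖θ‖ = 1) : IsDensity (ketbra θ) :=
  ⟨ketbra_posSemidef θ, trace_ketbra θ hθ⟩

/-- High moments of the overlap of two independent Haar-random states are small. -/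
theorem integral_overlap_pow_le (m : ℕ) {c : ℝ} (hc : 0 ≤ c) :
    ∫ θ, (ketbra (θ 0).1 * ketbra (θ 1).1).trace.re ^ m
        ∂(Measure.pi fun _ : Fin 2 => haar W) ≤
      c ^ m + (2 + c) * (2 / (2 + c)) ^ Fintype.card (W → Bool) := by
  set ν := Measure.pi fun _ : Fin 2 => haar W
  set B := (2 + c) * (2 / (2 + c)) ^ Fintype.card (W → Bool) with hB
  have hB0 : 0 ≤ B := by positivity
  set S : Set (Fin 2 → Metric.sphere (0 : Ket W) 1) :=
    {θ | c ≤ ‖inner ℂ (θ 0).1 (θ 1).1‖ ^ 2} with hS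
  have hSm : MeasurableSet S := (isClosed_le continuous_const (by fun_prop)).measurableSet
  have hle : ν S ≤ ENNReal.ofReal B := by
    have hmp := measurePreserving_piFinTwo fun _ : Fin 2 => haar W
    set S' : Set (Metric.sphere (0 : Ket W) 1 × Metric.sphere (0 : Ket W) 1) :=
      {θ | c ≤ ‖inner ℂ θ.1.1 θ.2.1‖ ^ 2}
    have hSm' : MeasurableSet S' := (isClosed_le continuous_const (by fun_prop)).measurableSet
    have : ν S = ((haar W).prod (haar W)) S' := (hmp.measure_preimage hSm'.nullMeasurableSet)
    rw [this, Measure.prod_apply hSm']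
    -- Fubini: the cap bound holds uniformly in the first state, which may therefore be held fixed.
    refine (lintegral_mono (g := fun _ => ENNReal.ofReal B) fun θ => ?_).trans_eq ?_
    · exact haar_cap_le θ.1 (norm_eq_of_mem_sphere θ) hc
    · simp
  -- Below the threshold the power is at most c^m; above it the overlap is still at most 1.
  have hb : ∀ θ : Fin 2 → Metric.sphere (0 : Ket W) 1,
      (ketbra (θ 0).1 * ketbra (θ 1).1).trace.re ^ m ≤ c ^ m + S.indicator 1 θ := by
    intro θ
    rw [trace_ketbra_mul, Complex.ofReal_re]
    by_cases h : θ ∈ S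
    · rw [Set.indicator_of_mem h]
      have h1 : ‖inner ℂ (θ 0).1 (θ 1).1‖ ≤ 1 := by
        refine (norm_inner_le_norm _ _).trans_eq ?_
        rw [norm_eq_of_mem_sphere, norm_eq_of_mem_sphere, one_mul]
      have h2 : (‖inner ℂ (θ 0).1 (θ 1).1‖ ^ 2) ^ m ≤ 1 :=
        pow_le_one₀ (by positivity) (pow_le_one₀ (norm_nonneg _) h1)
      have : 0 ≤ c ^ m := by positivity
      simp only [Pi.one_apply]
      linarith
    · rw [Set.indicator_of_notMem h, add_zero]
      exact pow_le_pow_left₀ (by positivity) (not_le.1 h).le m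
  have hi : Integrable (S.indicator (1 : (Fin 2 → Metric.sphere (0 : Ket W) 1) → ℝ)) ν :=
    (integrable_indicator_iff hSm).2 (integrable_const 1).integrableOn
  refine (integral_mono_of_nonneg (ae_of_all _ fun θ => ?_) ((integrable_const (c ^ m)).add hi)
    (ae_of_all _ hb)).trans ?_
  · simp only [Pi.zero_apply]
    rw [trace_ketbra_mul, Complex.ofReal_re]
    positivity
  · simp only [Pi.add_apply]
    rw [integral_add (integrable_const _) hi, integral_indicator_one hSm]
    simp only [integral_const, probReal_univ, one_smul]
    refine add_le_add_right ?_ _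
    exact ENNReal.toReal_le_of_le_ofReal hB0 hle

end Haar

/-! ### Purity -/

section Purity

variable {W : Type} [Fintype W] [DecidableEq W]

theorem frobSq_eq_trace_mul_self {ρ : Op W} (hρ : ρ.IsHermitian) :
    frobSq ρ = (ρ * ρ).trace.re := by
  have h := frobSq_eq_trace ρ
  rw [hρ.eq] at h
  rw [← h, Complex.ofReal_re]

theorem frobSq_smul (c : ℝ) (A : Op W) : frobSq ((c : ℂ) • A) = c ^ 2 * frobSq A := by
  simp [frobSq, mul_pow, Finset.mul_sum]

theorem frobSq_ketbra (θ : Ket W) (hθ : ‖θ‖ = 1) : frobSq (ketbra θ) = 1 := by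
  rw [frobSq_eq_trace_mul_self (ketbra_posSemidef θ).isHermitian, trace_ketbra_mul,
    Complex.ofReal_re, inner_self_eq_norm_sq_to_K, hθ]
  simp

theorem isDensity_mix {φ ψ : Ket W} (hφ : ‖φ‖ = 1) (hψ : ‖ψ‖ = 1) {η : ℝ} (h0 : 0 ≤ η)
    (h1 : η ≤ 1) : IsDensity ((η : ℂ) • ketbra φ + ((1 - η : ℝ) : ℂ) • ketbra ψ) := by
  refine ⟨((ketbra_posSemidef φ).smul (by exact_mod_cast h0)).add
    ((ketbra_posSemidef ψ).smul (by exact_mod_cast sub_nonneg.2 h1)), ?_⟩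
  rw [Matrix.trace_add, Matrix.trace_smul, Matrix.trace_smul, trace_ketbra φ hφ, trace_ketbra ψ hψ]
  simp

theorem frobSq_mix_le {φ ψ : Ket W} (hφ : ‖φ‖ = 1) (hψ : ‖ψ‖ = 1) {η : ℝ} (h0 : 0 ≤ η)
    (h1 : η ≤ 1) : frobSq ((η : ℂ) • ketbra φ + ((1 - η : ℝ) : ℂ) • ketbra ψ) ≤ 1 := by
  have h := sqrt_frobSq_add_le ((η : ℂ) • ketbra φ) (((1 - η : ℝ) : ℂ) • ketbra ψ)
  rw [frobSq_smul, frobSq_smul, frobSq_ketbra φ hφ, frobSq_ketbra ψ hψ, mul_one, mul_one,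
    Real.sqrt_sq h0, Real.sqrt_sq (sub_nonneg.2 h1), add_sub_cancel, Real.sqrt_le_left zero_le_one, one_pow] at h
  exact h

theorem frobSq_sub_eq {ρ σ : Op W} (hρ : ρ.IsHermitian) (hσ : σ.IsHermitian) :
    frobSq (ρ - σ) = frobSq ρ + frobSq σ - 2 * (ρ * σ).trace.re := by
  rw [frobSq_eq_trace_mul_self (hρ.sub hσ), frobSq_eq_trace_mul_self hρ,
    frobSq_eq_trace_mul_self hσ, sub_mul, mul_sub, mul_sub, Matrix.trace_sub, Matrix.trace_sub,
    Matrix.trace_sub, Matrix.trace_mul_comm σ ρ]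
  simp
  ring

/-- Two almost pure confusable states have a large overlap. -/
theorem one_le_of_confusable {n : ℕ} {ρ σ : Op (Fin n)} (hρ : ρ.IsHermitian) (hσ : σ.IsHermitian)
    (hρ1 : frobSq ρ ≤ 1) (hσ1 : frobSq σ ≤ 1) (h : Confusable ρ σ) (m : ℕ) :
    1 ≤ 4 * (1 - frobSq ρ) + 4 * (1 - frobSq σ) + 4 ^ m * (ρ * σ).trace.re ^ (2 * m) := by
  rw [Confusable, frobSq_sub_eq hρ hσ] at h
  have hX : 0 ≤ 4 ^ m * (ρ * σ).trace.re ^ (2 * m) := by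
    rw [pow_mul]; positivity
  -- A purity below 3/4 makes its impurity term exceed 1. Otherwise the overlap is at least (3/2 -
  -- 9/32)/2 = 39/64 > 1/2.
  by_cases h1 : frobSq ρ < 3 / 4
  · linarith
  by_cases h2 : frobSq σ < 3 / 4
  · linarith
  have h3 : 1 ≤ 4 ^ m * (ρ * σ).trace.re ^ (2 * m) := by
    rw [pow_mul, ← mul_pow]
    refine one_le_pow₀ ?_
    nlinarith
  linarith

theorem traceFirst_flagged {n : ℕ} (a c : ℂ) (A B : Op (Fin n)) :
    traceFirst (a • flagged false A + c • flagged true B) = a • A + c • B := by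
  ext u v
  simp [traceFirst, flagged]
  ring

/-- With recognizable abort, the generator outputs mixtures of two pure states. -/
theorem exists_mix_of_recognizableAbort {d n : ℕ → ℕ} {G : Generator d n}
    (h : RecognizableAbort G) (l : ℕ) (k : Fin l → Bool) (x : Fin (d l) → Bool) :
    ∃ (η : ℝ) (φ ψ : Ket (Fin (n l))), 0 ≤ η ∧ η ≤ 1 ∧ ‖φ‖ = 1 ∧ ‖ψ‖ = 1 ∧
      G.state l k x = (η : ℂ) • ketbra φ + ((1 - η : ℝ) : ℂ) • ketbra ψ := by
  obtain ⟨G', bot, hbot, h⟩ := h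
  obtain ⟨⟨η, ψ, h0, h1, hψ, he⟩, hs⟩ := h l k x
  exact ⟨η, ψ, bot l, h0, h1, hψ, hbot l, by rw [hs, he, traceFirst_flagged]⟩

theorem isDensity_state {d n : ℕ → ℕ} {G : Generator d n}
    (h : RecognizableAbort G) (l : ℕ) (k : Fin l → Bool) (x : Fin (d l) → Bool) :
    IsDensity (G.state l k x) := by
  obtain ⟨η, φ, ψ, h0, h1, hφ, hψ, he⟩ := exists_mix_of_recognizableAbort h l k x
  exact he ▸ isDensity_mix hφ hψ h0 h1

theorem frobSq_state_le_one {d n : ℕ → ℕ} {G : Generator d n}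
    (h : RecognizableAbort G) (l : ℕ) (k : Fin l → Bool) (x : Fin (d l) → Bool) :
    frobSq (G.state l k x) ≤ 1 := by
  obtain ⟨η, φ, ψ, h0, h1, hφ, hψ, he⟩ := exists_mix_of_recognizableAbort h l k x
  exact he ▸ frobSq_mix_le hφ hψ h0 h1

end Purity

/-! ### Overlaps as sums of Pauli correlators -/

section Correlator

variable {n : ℕ}

theorem sum_pauliMean_mul {ρ σ : Op (Fin n)} (hρ : ρ.IsHermitian) (hσ : σ.IsHermitian) :
    ∑ p, pauliMean ρ p * pauliMean σ p = 2 ^ n * (ρ * σ).trace.re := by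
  have h := sum_trace_pauli_mul ρ σ
  simp only [← coe_pauliMean hρ, ← coe_pauliMean hσ] at h
  have h2 := congrArg Complex.re h
  rw [show (2 : ℂ) ^ n = ((2 ^ n : ℝ) : ℂ) by push_cast; rfl, Complex.re_ofReal_mul] at h2
  rw [← h2, Complex.re_sum]
  exact Finset.sum_congr rfl fun p _ => by rw [← Complex.ofReal_mul, Complex.ofReal_re]

/-- Parseval writes N tr ρσ as a sum over Pauli strings; its m-th power is a sum over m-tuples of
strings, measured on m copies of each state. -/
theorem overlap_pow_eq_sum_correlator (m : ℕ) {σ : Fin 2 → Op (Fin n)} (hσ : ∀ i, IsDensity (σ i)) :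
    (σ 0 * σ 1).trace.re ^ m = ((2 ^ n) ^ m)⁻¹ *
      ∑ Q : Fin m → Fin n → Fin 4, correlator (fun _ => Q) σ := by
  have h := sum_pauliMean_mul (hσ 0).1.isHermitian (hσ 1).1.isHermitian
  have h2 : ∑ Q : Fin m → Fin n → Fin 4, correlator (fun _ => Q) σ =
      (∑ p, pauliMean (σ 0) p * pauliMean (σ 1) p) ^ m := by
    have := Finset.prod_univ_sum (fun _ : Fin m => (Finset.univ : Finset (Fin n → Fin 4)))
      (fun _ p => pauliMean (σ 0) p * pauliMean (σ 1) p)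
    rw [Finset.prod_const, Finset.card_univ, Fintype.card_fin, Fintype.piFinset_univ] at this
    rw [this]
    refine Finset.sum_congr rfl fun Q _ => ?_
    rw [correlator, Fin.prod_univ_two, Finset.prod_mul_distrib]
    rfl
  rw [h2, h, mul_pow, inv_mul_cancel_left₀ (by positivity)]

/-- Purity is the overlap of two copies of the same state. The other state is measured with
identities only, which contributes 1. -/
theorem frobSq_eq_sum_correlator {σ : Fin 2 → Op (Fin n)} (hσ : ∀ i, IsDensity (σ i)) (b : Fin 2) :
    frobSq (σ b) = (2 ^ n)⁻¹ *
      ∑ p : Fin n → Fin 4, correlator (fun i (_ : Fin 2) => if i = b then p else fun _ => 0) σ := by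
  have h := sum_pauliMean_mul (hσ b).1.isHermitian (hσ b).1.isHermitian
  have h2 : ∀ p, correlator (fun i (_ : Fin 2) => if i = b then p else fun _ => 0) σ =
      pauliMean (σ b) p * pauliMean (σ b) p := by
    intro p
    rw [correlator, Fintype.prod_eq_single b]
    · simp only [if_true, Fin.prod_univ_two]
      rfl
    · intro i hi
      simp [hi, pauli_zero, (hσ i).2]
  rw [Finset.sum_congr rfl fun p _ => h2 p, h, inv_mul_cancel_left₀ (by positivity),
    frobSq_eq_trace_mul_self (hσ b).1.isHermitian]

theorem continuous_correlator {s t : ℕ} (Q : Fin s → Fin t → Fin n → Fin 4) :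
    Continuous fun θ : Fin s → Metric.sphere (0 : Ket (Fin n)) 1 =>
      correlator Q fun i => ketbra (θ i).1 := by
  simp only [correlator, Matrix.trace, Matrix.diag, Matrix.mul_apply, ketbra, Matrix.of_apply]
  fun_prop

theorem integrable_correlator {s t : ℕ} (Q : Fin s → Fin t → Fin n → Fin 4) :
    Integrable (fun θ : Fin s → Metric.sphere (0 : Ket (Fin n)) 1 =>
      correlator Q fun i => ketbra (θ i).1) (Measure.pi fun _ => haar (Fin n)) :=
  (continuous_correlator Q).integrable_of_hasCompactSupport (HasCompactSupport.of_compactSpace _)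

end Correlator

/-! ### Consequences of pseudorandomness -/

section Security

variable {G : Generator inLen outLen}

/-- The two states of a block. -/
def blockStates (G : Generator inLen outLen) (l : ℕ) (k : Fin l → Bool)
    (i : Fin (idxLen l) → Bool) : Fin 2 → Op (Fin (outLen l)) :=
  fun b => Phi G l k i (b == 1)

/-- The average over the keys. -/
def keyAvg (l : ℕ) (F : (Fin l → Bool) → ℝ) : ℝ := (∑ k, F k) / 2 ^ l

theorem clog_two_le_self (l : ℕ) : Nat.clog 2 l ≤ l :=
  Nat.clog_le_of_le_pow Nat.lt_two_pow_self.le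

theorem negligible_const_mul {ε : ℕ → ℝ} (h : Negligible ε) (c : ℝ) :
    Negligible fun l => c * ε l :=
  Asymptotics.SuperpolynomialDecay.const_mul h c

/-- The Pauli correlators of the two states of a block are close to those of Haar-random states,
uniformly over blocks and Pauli strings. -/
theorem exists_negligible_correlator (hG : IsPRFS G) (habort : RecognizableAbort G) (t : ℕ) :
    ∃ ε : ℕ → ℝ, Negligible ε ∧ ∀ (l : ℕ) (i : Fin (idxLen l) → Bool)
      (Q : Fin 2 → Fin t → Fin (outLen l) → Fin 4),
      |keyAvg l (fun k => correlator Q (blockStates G l k i)) -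
        ∫ θ, correlator Q (fun b => ketbra (θ b).1)
          ∂(Measure.pi fun _ : Fin 2 => haar (Fin (outLen l)))| ≤ ε l := by
  set D : ∀ l, (Fin (idxLen l) → Bool) × (Fin 2 → Fin t → Fin (outLen l) → Fin 4) → ℝ :=
    fun l w => |keyAvg l (fun k => correlator w.2 (blockStates G l k w.1)) -
        ∫ θ, correlator w.2 (fun b => ketbra (θ b).1)
          ∂(Measure.pi fun _ : Fin 2 => haar (Fin (outLen l)))| with hD
  -- Non-uniformity: for each l the block and Pauli string with the largest advantage are hardwired.
  -- One distinguisher family then bounds all of them by a single negligible function.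
  have hmax : ∀ l, ∃ w, ∀ w', D l w' ≤ D l w := fun l => Finite.exists_max (D l)
  choose w hw using hmax
  set x : ∀ l, Fin 2 → Fin (inLen l) → Bool := fun l b =>
    (Fin.snoc (α := fun _ => Bool) (w l).1 (b == 1) : Fin (idxLen l + 1) → Bool) with hx
  -- The two inputs share the block index but end in different bits.
  have hxi : ∀ l, Function.Injective (x l) := by
    intro l a b hab
    have h : (a == 1) = (b == 1) := by
      have := congrFun hab (Fin.last (idxLen l))
      simpa only [hx, Fin.snoc_last] using this
    fin_cases a <;> fin_cases b <;> simp_all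
  have hpoly : IsQPT fun l => parityCircuit (copiesString (d := inLen l) (q := 0) (w l).2) := by
    refine ⟨10 * (2 * (Polynomial.X + 1) + 2 * (Polynomial.C t * Polynomial.X)) + 2, fun l => ?_⟩
    refine (size_parityCircuit_le _).trans ?_
    have h1 : inLen l ≤ l + 1 := Nat.succ_le_succ (clog_two_le_self l)
    have h2 : t * outLen l ≤ t * l := Nat.mul_le_mul_left t (clog_two_le_self l)
    simp only [Fintype.card_sum, Fintype.card_prod, Fintype.card_fin, Polynomial.eval_add,
      Polynomial.eval_mul, Polynomial.eval_X, Polynomial.eval_C, Polynomial.eval_one,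
      Polynomial.eval_ofNat]
    omega
  have hconst : ∀ c : ℕ, PolyBounded fun _ => c := fun c => ⟨Polynomial.C c, fun l => by simp⟩
  obtain ⟨ε, hε, h⟩ := hG.2 (fun _ => 2) (fun _ => t) (fun _ => 0)
    (fun l => parityCircuit (copiesString (w l).2)) (fun _ => 1) x (hconst 2) (hconst t) hpoly
    (fun l => ⟨Matrix.PosSemidef.one, by simp [Matrix.trace]⟩) hxi
  -- The acceptance probability is (1 - correlator)/2, so the advantage doubles.
  refine ⟨fun l => 2 * ε l, negligible_const_mul hε 2, fun l i Q => (hw l (i, Q)).trans ?_⟩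
  have hl := h l
  have hreal : realProb G l 2 t 0 (parityCircuit (copiesString (w l).2)) 1 (x l) =
      (1 - keyAvg l fun k => correlator (w l).2 (blockStates G l k (w l).1)) / 2 := by
    rw [realProb, Finset.sum_congr rfl fun k _ => acceptProb_copiesString (w l).2 (x l)
      fun b => isDensity_state habort l k (x l b), keyAvg, ← Finset.sum_div,
      Finset.sum_sub_distrib]
    simp only [Finset.sum_const, Finset.card_univ, Fintype.card_fun, Fintype.card_bool,
      Fintype.card_fin, nsmul_eq_mul, mul_one]
    push_cast
    field_simp
    rfl
  have hhaar : haarProb 2 t (inLen l) (outLen l) 0 (parityCircuit (copiesString (w l).2)) 1 (x l) =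
      (1 - ∫ θ, correlator (w l).2 (fun b => ketbra (θ b).1)
          ∂(Measure.pi fun _ : Fin 2 => haar (Fin (outLen l)))) / 2 := by
    have h1 : ∀ θ : Fin 2 → Metric.sphere (0 : Ket (Fin (outLen l))) 1,
        (parityCircuit (copiesString (w l).2)).acceptProb
          (challenge t (x l) (fun i => ketbra (θ i).1) 1) =
        (1 - correlator (w l).2 fun b => ketbra (θ b).1) / 2 := fun θ =>
      acceptProb_copiesString (w l).2 (x l) fun b =>
        isDensity_ketbra _ (norm_eq_of_mem_sphere (θ b))
    rw [haarProb, integral_congr_ae (ae_of_all _ h1), integral_div,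
      integral_sub (integrable_const _) (integrable_correlator _)]
    simp
  rw [hreal, hhaar] at hl
  rw [hD]
  simp only
  rw [abs_le] at hl ⊢
  constructor <;> linarith [hl.1, hl.2]

/-- Functions that are short combinations of Pauli correlators do not distinguish the states of a
block from Haar-random states. -/
theorem abs_keyAvg_sub_integral_le {t l : ℕ} {i : Fin (idxLen l) → Bool} {ε : ℝ}
    (habort : RecognizableAbort G)
    (h : ∀ Q : Fin 2 → Fin t → Fin (outLen l) → Fin 4,
      |keyAvg l (fun k => correlator Q (blockStates G l k i)) -
        ∫ θ, correlator Q (fun b => ketbra (θ b).1)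
          ∂(Measure.pi fun _ : Fin 2 => haar (Fin (outLen l)))| ≤ ε)
    {ι : Type} [Fintype ι] (Q : ι → Fin 2 → Fin t → Fin (outLen l) → Fin 4) {c : ℝ} (hc : 0 ≤ c)
    (F : (Fin 2 → Op (Fin (outLen l))) → ℝ)
    (hF : ∀ σ, (∀ b, IsDensity (σ b)) → F σ = c * ∑ a, correlator (Q a) σ) :
    |keyAvg l (fun k => F (blockStates G l k i)) - ∫ θ, F (fun b => ketbra (θ b).1)
          ∂(Measure.pi fun _ : Fin 2 => haar (Fin (outLen l)))| ≤ c * (Fintype.card ι * ε) := by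
  have h1 : keyAvg l (fun k => F (blockStates G l k i)) =
      c * ∑ a, keyAvg l (fun k => correlator (Q a) (blockStates G l k i)) := by
    have hk : ∀ k, F (blockStates G l k i) = c * ∑ a, correlator (Q a) (blockStates G l k i) :=
      fun k => hF _ fun b => isDensity_state habort l _ _
    simp only [keyAvg, hk, ← Finset.mul_sum, ← Finset.sum_div]
    rw [Finset.sum_comm, mul_div_assoc]
  have h2 : ∫ θ, F (fun b => ketbra (θ b).1)
        ∂(Measure.pi fun _ : Fin 2 => haar (Fin (outLen l))) =
      c * ∑ a, ∫ θ, correlator (Q a) (fun b => ketbra (θ b).1)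
        ∂(Measure.pi fun _ : Fin 2 => haar (Fin (outLen l))) := by
    rw [← integral_finsetSum _ fun a _ => integrable_correlator (Q a), ← integral_const_mul]
    exact integral_congr_ae (ae_of_all _ fun θ =>
      hF _ fun b => isDensity_ketbra _ (norm_eq_of_mem_sphere (θ b)))
  rw [h1, h2, ← mul_sub, ← Finset.sum_sub_distrib, abs_mul, abs_of_nonneg hc]
  refine mul_le_mul_of_nonneg_left ((Finset.abs_sum_le_sum_abs _ _).trans ?_) hc
  refine (Finset.sum_le_sum fun a _ => h (Q a)).trans_eq ?_
  simp

end Security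

/-! ### Negligible functions -/

theorem Negligible.add {f g : ℕ → ℝ} (hf : Negligible f) (hg : Negligible g) :
    Negligible fun l => f l + g l :=
  Asymptotics.SuperpolynomialDecay.add hf hg

theorem Negligible.linear_mul {f : ℕ → ℝ} (hf : Negligible f) :
    Negligible fun l => (2 * (l : ℝ) + 1) * f l := by
  have h := Asymptotics.SuperpolynomialDecay.polynomial_mul hf
    (2 * Polynomial.X + 1 : Polynomial ℝ)
  simpa [Negligible] using h

theorem Negligible.linear_pow_mul {f : ℕ → ℝ} (hf : Negligible f) (m : ℕ) :
    Negligible fun l => (2 * (l : ℝ) + 1) ^ m * f l := by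
  induction m with
  | zero => simpa using hf
  | succ m ih =>
    have h := ih.linear_mul
    simp only [← mul_assoc, ← pow_succ'] at h
    exact h

theorem negligible_pow {r : ℝ} (h0 : 0 ≤ r) (h1 : r < 1) : Negligible fun l => r ^ l := fun z =>
  tendsto_pow_const_mul_const_pow_of_abs_lt_one z (by rwa [abs_of_nonneg h0])

theorem negligible_exp_neg_sqrt : Negligible fun l => Real.exp (-(√l / 4)) := by
  intro z
  have h1 : Tendsto (fun l : ℕ => √(l : ℝ) / 4) atTop atTop :=
    (Real.tendsto_sqrt_atTop.comp tendsto_natCast_atTop_atTop).atTop_div_const (by norm_num)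
  -- With u = √l / 4 one has l = 16 u², so l^z becomes 16^z u^(2z).
  have h2 := ((Real.tendsto_pow_mul_exp_neg_atTop_nhds_zero (2 * z)).comp h1).const_mul (16 ^ z)
  rw [mul_zero] at h2
  refine h2.congr fun l => ?_
  simp only [Function.comp_apply]
  rw [← mul_assoc, pow_mul, ← mul_pow, div_pow, Real.sq_sqrt (Nat.cast_nonneg l)]
  congr 2
  ring

/-- A function that is, for every `m`, at most a negligible function plus a constant times `l⁻ᵐ`
is negligible. -/
theorem negligible_of_forall_le {f : ℕ → ℝ} (h0 : ∀ l, 0 ≤ f l)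
    (h : ∀ m : ℕ, ∃ g : ℕ → ℝ, ∃ C : ℝ, Negligible g ∧
      ∀ l : ℕ, 0 < l → f l ≤ g l + C * ((l : ℝ) ^ m)⁻¹) : Negligible f := by
  intro z
  -- One order more than z leaves a factor 1/l, which tends to 0.
  obtain ⟨g, C, hg, hle⟩ := h (z + 1)
  have h1 : Tendsto (fun l : ℕ => (l : ℝ) ^ z * g l + C * (l : ℝ)⁻¹) atTop (nhds 0) := by
    have := (hg z).add ((tendsto_inv_atTop_nhds_zero_nat (𝕜 := ℝ)).const_mul C)
    rwa [mul_zero, add_zero] at this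
  refine squeeze_zero' (Eventually.of_forall fun l => mul_nonneg (by positivity) (h0 l)) ?_ h1
  filter_upwards [eventually_gt_atTop 0] with l hl
  have hl' : (0 : ℝ) < l := by exact_mod_cast hl
  refine (mul_le_mul_of_nonneg_left (hle l hl) (by positivity)).trans_eq ?_
  field_simp
  ring

/-- The dimension N is linear in l, which keeps sums over Pauli strings polynomial. The summand 1
covers l = 0, where the logarithm is read as 0. -/
theorem two_pow_clog_le (l : ℕ) : (2 : ℝ) ^ Nat.clog 2 l ≤ 2 * l + 1 := by
  have h : 2 ^ Nat.clog 2 l ≤ 2 * l + 1 := by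
    rcases Nat.lt_or_ge 1 l with hl | hl
    · have h1 := Nat.pow_pred_clog_lt_self one_lt_two hl
      have h2 := Nat.clog_pos one_lt_two hl
      obtain ⟨m, hm⟩ := Nat.exists_eq_succ_of_ne_zero h2.ne'
      rw [hm] at h1 ⊢
      rw [pow_succ]
      simp only [Nat.pred_succ] at h1
      omega
    · rw [Nat.clog_of_right_le_one hl]
      omega
  exact_mod_cast h

theorem le_two_pow_clog (l : ℕ) : (l : ℝ) ≤ 2 ^ Nat.clog 2 l := by
  exact_mod_cast Nat.le_pow_clog one_lt_two l

/-! ### Confusable pairs are rare -/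

/-- The tail term of the moments of the overlap of Haar-random states, for the threshold `N^(-1/2)`. -/
theorem overlap_tail_le {N : ℕ} (hN : 0 < N) :
    (2 + (√N)⁻¹) * (2 / (2 + (√N)⁻¹)) ^ N ≤ 3 * Real.exp (-(√N / 4)) := by
  have hN' : (1 : ℝ) ≤ N := by exact_mod_cast hN
  have hs : 1 ≤ √(N : ℝ) := Real.one_le_sqrt.2 hN'
  set c := (√(N : ℝ))⁻¹ with hc
  have hc0 : 0 < c := by positivity
  have hc1 : c ≤ 1 := inv_le_one_of_one_le₀ hs
  have h1 : 2 / (2 + c) ≤ Real.exp (-(c / 4)) := by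
    have h2 : 2 / (2 + c) ≤ 1 - c / 4 := by
      rw [div_le_iff₀ (by positivity)]
      nlinarith
    have h3 := Real.add_one_le_exp (-(c / 4))
    linarith
  have h4 : (2 / (2 + c)) ^ N ≤ Real.exp (-(√N / 4)) := by
    refine (pow_le_pow_left₀ (by positivity) h1 N).trans_eq ?_
    rw [← Real.exp_nat_mul]
    congr 1
    have : (N : ℝ) * c = √N := by
      rw [hc, ← div_eq_mul_inv, Real.div_sqrt]
    linear_combination (-1 / 4) * this
  gcongr
  linarith

section Security

variable {G : Generator inLen outLen}

/-- The probability over the keys that the two states of a block are confusable. -/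
def confusableProb (G : Generator inLen outLen) (l : ℕ) (i : Fin (idxLen l) → Bool) : ℝ :=
  open Classical in
  keyAvg l fun k => if Confusable (Phi G l k i true) (Phi G l k i false) then 1 else 0

theorem prob_confusable (l : ℕ) (i : Fin (idxLen l) → Bool) :
    prob (PMF.uniformOfFintype (Fin l → Bool))
      (fun k => Confusable (Phi G l k i true) (Phi G l k i false)) =
      ENNReal.ofReal (confusableProb G l i) := by
  classical
  have h : ∀ k, (if Confusable (Phi G l k i true) (Phi G l k i false) then (1 : ENNReal) else 0) =
      ENNReal.ofReal (if Confusable (Phi G l k i true) (Phi G l k i false) then 1 else 0) :=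
    fun k => by split_ifs <;> simp
  rw [prob, confusableProb, keyAvg]
  refine (congrArg _ (funext fun k => ?_)).trans ((expect_ofReal _
    (fun k => if Confusable (Phi G l k i true) (Phi G l k i false) then (1 : ℝ) else 0)
    fun k => by split_ifs <;> simp).trans ?_)
  · split_ifs <;> simp
  · congr 1
    rw [Finset.sum_div]
    refine Finset.sum_congr rfl fun k _ => ?_
    rw [PMF.uniformOfFintype_apply]
    simp [div_eq_mul_inv, mul_comm]

theorem confusableProb_nonneg (l : ℕ) (i : Fin (idxLen l) → Bool) : 0 ≤ confusableProb G l i := by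
  classical
  refine div_nonneg (Finset.sum_nonneg fun k _ => ?_) (by positivity)
  split_ifs <;> simp

theorem keyAvg_mono {l : ℕ} {F F' : (Fin l → Bool) → ℝ} (h : ∀ k, F k ≤ F' k) :
    keyAvg l F ≤ keyAvg l F' :=
  div_le_div_of_nonneg_right (Finset.sum_le_sum fun k _ => h k) (by positivity)

/-- Average of `one_le_of_confusable` over the keys. For keys without confusion the right side is
nonnegative because purities are at most 1. -/
theorem confusableProb_le_keyAvg (habort : RecognizableAbort G) (m l : ℕ)
    (i : Fin (idxLen l) → Bool) :
    confusableProb G l i ≤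
      4 * (1 - keyAvg l fun k => frobSq (blockStates G l k i 0)) +
      4 * (1 - keyAvg l fun k => frobSq (blockStates G l k i 1)) +
      4 ^ m * keyAvg l fun k =>
        (blockStates G l k i 0 * blockStates G l k i 1).trace.re ^ (2 * m) := by
  classical
  have h : ∀ k, (if Confusable (Phi G l k i true) (Phi G l k i false) then (1 : ℝ) else 0) ≤
      4 * (1 - frobSq (blockStates G l k i 0)) + 4 * (1 - frobSq (blockStates G l k i 1)) +
      4 ^ m * (blockStates G l k i 0 * blockStates G l k i 1).trace.re ^ (2 * m) := by
    intro k
    have hd : ∀ b, IsDensity (blockStates G l k i b) := fun b => isDensity_state habort l _ _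
    have h1 : ∀ b, frobSq (blockStates G l k i b) ≤ 1 := fun b => frobSq_state_le_one habort l _ _
    split_ifs with hc
    · refine one_le_of_confusable (hd 0).1.isHermitian (hd 1).1.isHermitian (h1 0) (h1 1) ?_ m
      rw [Confusable, frobSq_sub_comm]
      exact hc
    · have h2 : 0 ≤ (blockStates G l k i 0 * blockStates G l k i 1).trace.re ^ (2 * m) := by
        rw [pow_mul]; positivity
      have h3 : (0 : ℝ) ≤ 4 ^ m * (blockStates G l k i 0 * blockStates G l k i 1).trace.re ^ (2 * m) :=
        by positivity
      linarith [h1 0, h1 1]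
  refine (keyAvg_mono h).trans_eq ?_
  simp only [keyAvg, Finset.sum_add_distrib, ← Finset.mul_sum, Finset.sum_sub_distrib]
  simp only [Finset.sum_const, Finset.card_univ, Fintype.card_fun, Fintype.card_bool,
    Fintype.card_fin, nsmul_eq_mul, mul_one]
  push_cast
  field_simp

/-- Haar-random states are pure. Transferring the purity sums N² correlators with weight 1/N, a loss
of only N ≤ 2l + 1. -/
theorem exists_negligible_purity (hG : IsPRFS G) (habort : RecognizableAbort G) :
    ∃ ε : ℕ → ℝ, Negligible ε ∧ ∀ (l : ℕ) (i : Fin (idxLen l) → Bool) (b : Fin 2),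
      1 - keyAvg l (fun k => frobSq (blockStates G l k i b)) ≤ ε l := by
  obtain ⟨ε, hε, h⟩ := exists_negligible_correlator hG habort 2
  have hε0 : ∀ l, 0 ≤ ε l := fun l => (abs_nonneg _).trans (h l (fun _ => false) 0)
  refine ⟨fun l => (2 * (l : ℝ) + 1) * ε l, hε.linear_mul, fun l i b => ?_⟩
  have h1 := abs_keyAvg_sub_integral_le habort (h l i)
    (fun (p : Fin (outLen l) → Fin 4) i (_ : Fin 2) => if i = b then p else fun _ => 0)
    (c := (2 ^ outLen l)⁻¹) (by positivity) (fun σ => frobSq (σ b))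
    (fun σ hσ => frobSq_eq_sum_correlator hσ b)
  have h2 : ∫ θ, frobSq (ketbra (θ b).1)
      ∂(Measure.pi fun _ : Fin 2 => haar (Fin (outLen l))) = 1 := by
    rw [integral_congr_ae (ae_of_all _ fun θ => frobSq_ketbra _ (norm_eq_of_mem_sphere (θ b)))]
    simp
  rw [h2, Fintype.card_fun, Fintype.card_fin, Fintype.card_fin] at h1
  have h3 : ((2 : ℝ) ^ outLen l)⁻¹ * ((4 ^ outLen l : ℕ) * ε l) ≤ (2 * (l : ℝ) + 1) * ε l := by
    push_cast
    rw [show (4 : ℝ) ^ outLen l = 2 ^ outLen l * 2 ^ outLen l by rw [← mul_pow]; norm_num,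
      mul_assoc, inv_mul_cancel_left₀ (by positivity)]
    exact mul_le_mul_of_nonneg_right (two_pow_clog_le l) (hε0 l)
  have h4 := (abs_le.1 (h1.trans h3)).1
  linarith

/-- The transfer involves N^(4m) correlators with weight N^(-2m), so the loss N^(2m) is polynomial
for fixed m. The overlap threshold N^(-1/2) yields N^(-m) ≤ l^(-m) with a tail that is still
negligible. -/
theorem exists_negligible_overlap (hG : IsPRFS G) (habort : RecognizableAbort G) (m : ℕ) :
    ∃ ε : ℕ → ℝ, Negligible ε ∧ ∀ (l : ℕ), 0 < l → ∀ (i : Fin (idxLen l) → Bool),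
      keyAvg l (fun k => (blockStates G l k i 0 * blockStates G l k i 1).trace.re ^ (2 * m)) ≤
        ε l + ((l : ℝ) ^ m)⁻¹ := by
  obtain ⟨ε, hε, h⟩ := exists_negligible_correlator hG habort (2 * m)
  have hε0 : ∀ l, 0 ≤ ε l := fun l => (abs_nonneg _).trans (h l (fun _ => false) 0)
  refine ⟨fun l => (2 * (l : ℝ) + 1) ^ (2 * m) * ε l + 3 * Real.exp (-(√l / 4)),
    (hε.linear_pow_mul _).add (negligible_const_mul negligible_exp_neg_sqrt 3), fun l hl i => ?_⟩
  have hl' : (0 : ℝ) < l := by exact_mod_cast hl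
  have h1 := abs_keyAvg_sub_integral_le habort (h l i)
    (fun (Q : Fin (2 * m) → Fin (outLen l) → Fin 4) _ => Q)
    (c := ((2 ^ outLen l) ^ (2 * m))⁻¹) (by positivity) (fun σ => (σ 0 * σ 1).trace.re ^ (2 * m))
    (fun σ hσ => overlap_pow_eq_sum_correlator _ hσ)
  have h3 : (((2 : ℝ) ^ outLen l) ^ (2 * m))⁻¹ *
      (Fintype.card (Fin (2 * m) → Fin (outLen l) → Fin 4) * ε l) ≤
        (2 * (l : ℝ) + 1) ^ (2 * m) * ε l := by
    simp only [Fintype.card_fun, Fintype.card_fin]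
    push_cast
    rw [show (4 : ℝ) ^ outLen l = 2 ^ outLen l * 2 ^ outLen l by rw [← mul_pow]; norm_num,
      mul_pow, mul_assoc, inv_mul_cancel_left₀ (by positivity)]
    refine mul_le_mul_of_nonneg_right ?_ (hε0 l)
    exact pow_le_pow_left₀ (by positivity) (two_pow_clog_le l) _
  have h4 := (abs_le.1 (h1.trans h3)).2
  set N := Fintype.card (Fin (outLen l) → Bool) with hN
  have hNeq : (N : ℝ) = 2 ^ outLen l := by
    rw [hN, Fintype.card_fun, Fintype.card_bool, Fintype.card_fin]
    push_cast
    rfl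
  have hlN : (l : ℝ) ≤ N := hNeq ▸ le_two_pow_clog l
  have hN0 : 0 < N := Fintype.card_pos
  have h5 := (integral_overlap_pow_le (W := Fin (outLen l)) (2 * m) (c := (√N)⁻¹)
    (by positivity)).trans (add_le_add_right (overlap_tail_le hN0) _)
  have h6 : ((√N)⁻¹) ^ (2 * m) ≤ ((l : ℝ) ^ m)⁻¹ := by
    rw [pow_mul, inv_pow, Real.sq_sqrt (Nat.cast_nonneg _), inv_pow]
    gcongr
  have h7 : Real.exp (-(√N / 4)) ≤ Real.exp (-(√l / 4)) := by
    gcongr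
  linarith

/-- The bound is an m-dependent negligible function plus (4/l)^m, while the bounded quantity is the
same for all m. The supremum over the finitely many blocks makes it uniform. -/
theorem exists_negligible_confusable (hG : IsPRFS G) (habort : RecognizableAbort G) :
    ∃ δ : ℕ → ℝ, Negligible δ ∧ ∀ (l : ℕ) (i : Fin (idxLen l) → Bool),
      confusableProb G l i ≤ δ l := by
  have hle : ∀ l i, confusableProb G l i ≤ ⨆ i, confusableProb G l i := fun l i =>
    le_ciSup (Set.finite_range _).bddAbove i
  refine ⟨fun l => ⨆ i, confusableProb G l i, negligible_of_forall_le
    (fun l => Real.iSup_nonneg fun i => confusableProb_nonneg l i) fun m => ?_, hle⟩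
  obtain ⟨ε₁, hε₁, h₁⟩ := exists_negligible_purity hG habort
  obtain ⟨ε₂, hε₂, h₂⟩ := exists_negligible_overlap hG habort m
  refine ⟨fun l => 8 * ε₁ l + 4 ^ m * ε₂ l, 4 ^ m,
    (negligible_const_mul hε₁ 8).add (negligible_const_mul hε₂ _), fun l hl => ciSup_le fun i => ?_⟩
  refine (confusableProb_le_keyAvg habort m l i).trans ?_
  have h3 := mul_le_mul_of_nonneg_left (h₂ l hl i) (show (0 : ℝ) ≤ 4 ^ m by positivity)
  rw [mul_add] at h3
  linarith [h₁ l i 0, h₁ l i 1]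

end Security

end PseudoOTP

end

/-! ### Correctness of the scheme -/

theorem mainTheorem12 (G : PseudoOTP.Generator PseudoOTP.inLen PseudoOTP.outLen)
    (hG : PseudoOTP.IsPRFS G) (habort : PseudoOTP.RecognizableAbort G)
    (M : ℕ → ℕ) (hM : ∀ l, M l ≤ 2 ^ PseudoOTP.idxLen l) :
    ∃ ε : ℕ → ℝ, PseudoOTP.Negligible ε ∧
      ∀ (l : ℕ) (x : Fin (M l) → Bool),
        1 - ε l ≤ (PseudoOTP.decEnc G l (M l) x x).toReal := by
  open PseudoOTP in
  obtain ⟨δ, hδ, h⟩ := exists_negligible_confusable hG habort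
  have hδ0 : ∀ l, 0 ≤ δ l := fun l => (confusableProb_nonneg l fun _ => false).trans (h l _)
  have hr : √3 / 2 < 1 := by
    rw [div_lt_one (by norm_num), Real.sqrt_lt' (by norm_num)]
    norm_num
  -- The factor 2l + 1 bounds the number of blocks; the two summands are the errors of the two
  -- tomographs and of confusable states in one block.
  refine ⟨fun l => (2 * (l : ℝ) + 1) * (2 * (√3 / 2) ^ l + δ l),
    ((negligible_const_mul (negligible_pow (by positivity) hr) 2).add hδ).linear_mul,
    fun l x => ?_⟩
  have hM' : (M l : ℝ) ≤ 2 * l + 1 := le_trans (by exact_mod_cast hM l) (two_pow_clog_le l)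
  refine le_trans (sub_le_sub_left (mul_le_mul_of_nonneg_right hM' ?_) 1)
    (one_sub_decEnc_le G l (M l) x (fun k i b => isDensity_state habort l k _) (δ l) (hδ0 l)
      fun i => ?_)
  · have := hδ0 l
    positivity
  · rw [prob_confusable]
    exact ENNReal.ofReal_le_ofReal (h l _)
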